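/- **Setting.** Let $f:\mathbb R^n\to\mathbb R$ be differentiable and bounded below, and put $B=\inf_x f(x)$. Write $\mathrm{supp}(x)=\{i: x_i\ne 0\}$, call $x$ $k$-sparse if $|\mathrm{supp}(x)|\le k$, and let $x_R$ be the vector that agrees with $x$ on $R\subseteq[n]$ and is $0$ elsewhere. Let $x^*$ be an $s^*$-sparse vector and $s$ a sparsity level. * $\rho^+=\rho_2^+$ (restricted smoothness) is the least real with $f(y)\le f(x)+\langle\nabla f(x),y-x\rangle+\frac{\rho^+}{2}\|y-x\|_2^2$ for all $x,y$ with $y-x$ $2$-sparse. * $\rho^-=\rho^-_{s+s^*}$ (restricted strong convexity) is the greatest real $\ge 0$ with $f(y)\ge f(x)+\langle\nabla f(x),y-x\rangle+\frac{\rho^-}{2}\|y-x\|_2^2$ for all $x,y$ with $y-x$ $(s+s^*)$-sparse. Assume that $\rho^+$ and $\rho^-$ exist and $\rho^->0$, and put $\widetilde\kappa=\rho^+/\rho^-$. * The Restricted Gradient Optimal Constant (RGOC) of $f$ at $x^*$ at sparsity level $k$ is the least $\zeta\ge0$ with $|\langle\nabla f(x^*),y\rangle|\le\zeta\|y\|_2$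 for all $k$-sparse $y$. **Algorithm.** Let $g_R(x)=f(x)+\frac{\rho^+}{2}\|x_R\|_2^2$. Ties in the $\mathrm{argmax}$/$\mathrm{argmin}$ over indices are broken by an arbitrary fixed rule; logarithms are natural and iteration counts are rounded up to a non-negative integer. *ARHT_core*$(s,\mathrm{opt},\epsilon)$: $R^0=[n]$, $S^0=[s]\cap[n]$, $x^0=\mathrm{argmin}_{\mathrm{supp}(x)\subseteq S^0}g_{R^0}(x)$. For $2s\log\frac{f(0)-B}{\epsilon}$ iterations $t=0,1,\dots$: if $\min_{\mathrm{supp}(x)\subseteq S^t}f(x)\le\mathrm{opt}$, return the minimizer. Otherwise let $i=\mathrm{argmax}_{i\in[n]}|\nabla_i g_{R^t}(x^t)|$, $j=\mathrm{argmin}_{j\in S^t}|x^t_j|$, $S'=(S^t\cup\{i\})\setminus\{j\}$, $x'=\mathrm{argmin}_{\mathrm{supp}(x)\subseteq S'}g_{R^t}(x)$. If $g_{R^t}(x^t)-g_{R^t}(x')<\frac1s(g_{R^t}(x^t)-\mathrm{opt})$, set $S^{t+1}=S^t$, sample $i\in R^t$ with probability proportional to $(x^t_i)^2$, and set $R^{t+1}=R^t\setminus\{i\}$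 ($R^{t+1}=R^t$ if all these weights vanish) and $x^{t+1}=\mathrm{argmin}_{\mathrm{supp}(x)\subseteq S^{t+1}}g_{R^{t+1}}(x)$; else set $(S^{t+1},R^{t+1},x^{t+1})=(S',R^t,x')$. After the last iteration return the current $x$. *ARHT_robust*$(s,\mathrm{opt},\epsilon,B)$: start with $x^{\mathrm{ret}}=0$; $5\log\left(6n\log\frac{f(0)-B}{\epsilon}\right)$ times, run ARHT_core$(s,\mathrm{opt},\epsilon)$ with fresh randomness and replace $x^{\mathrm{ret}}$ by its output if that has a smaller value of $f$. Return $x^{\mathrm{ret}}$. *ARHT*$(s,\epsilon)$: $l=B$, $b=0$, $r=f(0)$. While $r-l>\epsilon$: let $m=\frac{l+r}{2}$ and let $x$ be the output of ARHT_robust$(s,m,\epsilon/3,B)$; if $f(x)>m+\epsilon/3$ set $l=m$, else set $b=x$, $r=f(x)$. Return $b$. **Corollary (Solution recovery).** Let $s\ge s^*\max\{4\widetilde\kappa+7,\,12\widetilde\kappa+6\}$ and $\epsilon>0$. Let $\zeta$ be the RGOC of $f$ at $x^*$ at sparsity level $s+s^*$; if $x^*$ minimizes $f$ among the vectors supported in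 $\mathrm{supp}(x^*)$, then $\zeta$ may instead be the RGOC at sparsity level $s$. Then, with probability at least $1-\frac1n$, the output $x$ of ARHT$(s,\epsilon)$ is $s$-sparse and satisfies $$f(x)\le f(x^*)+\epsilon,\qquad \|x-x^*\|_2\le\frac{\zeta+\sqrt{\zeta^2+2\epsilon\rho^-}}{\rho^-},$$ where for $\zeta>0$ the last bound reads $$\|x-x^*\|_2\le\frac{\zeta}{\rho^-}\left(1+\sqrt{1+2\epsilon\frac{\rho^-}{\zeta^2}}\right),$$ and, for every $\theta>0$ such that $\epsilon\le\frac{\zeta^2}{\rho^-}\theta\left(1+\frac\theta2\right)$, also $\|x-x^*\|_2\le(2+\theta)\frac{\zeta}{\rho^-}$. -/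

import Mathlib

noncomputable section

namespace ARHT

/-- `ℝⁿ` with the Euclidean norm. -/
abbrev E (n : ℕ) : Type := EuclideanSpace ℝ (Fin n)

/-- The support `{i : xᵢ ≠ 0}`. -/
def supp {n : ℕ} (x : E n) : Finset (Fin n) :=
  Finset.univ.filter fun i => x i ≠ 0

/-- `x` has at most `k` non-zero entries. -/
def IsSparse {n : ℕ} (k : ℕ) (x : E n) : Prop :=
  (supp x).card ≤ k

/-- The vector `x_R`, which agrees with `x` on `R` and is zero elsewhere. -/
def restrict {n : ℕ} (x : E n) (R : Finset (Fin n)) : E n :=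
  WithLp.toLp 2 fun i => if i ∈ R then x i else 0

/-- `ρ` is the restricted smoothness constant of `f` at sparsity level `k`: the least `ρ` with
`f y ≤ f x + ⟨∇ f x, y - x⟩ + (ρ / 2) ‖y - x‖²` whenever `y - x` is `k`-sparse. -/
def IsRSSConstant {n : ℕ} (f : E n → ℝ) (k : ℕ) (ρ : ℝ) : Prop :=
  IsLeast {c : ℝ | ∀ x y : E n, IsSparse k (y - x) →
    f y ≤ f x + inner ℝ (gradient f x) (y - x) + c / 2 * ‖y - x‖ ^ 2} ρ

/-- `ρ` is the restricted strong convexity constant of `f` at sparsity level `k`: the greatest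
`ρ ≥ 0` with `f y ≥ f x + ⟨∇ f x, y - x⟩ + (ρ / 2) ‖y - x‖²` whenever `y - x` is `k`-sparse. -/
def IsRSCConstant {n : ℕ} (f : E n → ℝ) (k : ℕ) (ρ : ℝ) : Prop :=
  IsGreatest {c : ℝ | 0 ≤ c ∧ ∀ x y : E n, IsSparse k (y - x) →
    f x + inner ℝ (gradient f x) (y - x) + c / 2 * ‖y - x‖ ^ 2 ≤ f y} ρ

/-- `ζ` is the restricted gradient optimal constant of `f` at `z` at sparsity level `k`: the least
`ζ ≥ 0` with `|⟨∇ f z, y⟩| ≤ ζ ‖y‖` for all `k`-sparse `y`. -/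
def IsRGOC {n : ℕ} (f : E n → ℝ) (z : E n) (k : ℕ) (ζ : ℝ) : Prop :=
  IsLeast {c : ℝ | 0 ≤ c ∧ ∀ y : E n, IsSparse k y →
    |inner ℝ (gradient f z) y| ≤ c * ‖y‖} ζ

/-- `x` is an `S`-restricted minimizer of `f`. -/
def IsRestrictedMinimizer {n : ℕ} (f : E n → ℝ) (S : Finset (Fin n)) (x : E n) : Prop :=
  supp x ⊆ S ∧ ∀ y : E n, supp y ⊆ S → f x ≤ f y

open Classical in
/-- `argmin {f x | supp x ⊆ S}` (with the value `0` if there is no minimizer). -/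
def restrictedArgmin {n : ℕ} (f : E n → ℝ) (S : Finset (Fin n)) : E n :=
  if h : ∃ x, IsRestrictedMinimizer f S x then h.choose else 0

/-- `sel` is a rule that selects, from every non-empty set `A` of indices and every real function
`φ` on the indices, an element of `argmax {φ i | i ∈ A}`. Ties are broken arbitrarily. -/
def IsArgmaxRule {n : ℕ} (sel : Finset (Fin n) → (Fin n → ℝ) → Fin n) : Prop :=
  ∀ (A : Finset (Fin n)) (φ : Fin n → ℝ), A.Nonempty →
    sel A φ ∈ A ∧ ∀ i ∈ A, φ i ≤ φ (sel A φ)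

/-- The regularized objective `g_R(x) = f(x) + (ρ / 2) ‖x_R‖²`. -/
def regularized {n : ℕ} (f : E n → ℝ) (ρ : ℝ) (R : Finset (Fin n)) (x : E n) : ℝ :=
  f x + ρ / 2 * ‖restrict x R‖ ^ 2

/-- The weights `xᵢ²`, `i ∈ R`. -/
def sampleWeight {n : ℕ} (R : Finset (Fin n)) (x : E n) (i : Fin n) : ENNReal :=
  if i ∈ R then ENNReal.ofReal (x i ^ 2) else 0

lemma tsum_sampleWeight_ne_top {n : ℕ} (R : Finset (Fin n)) (x : E n) :
    ∑' i, sampleWeight R x i ≠ ⊤ := by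
  rw [tsum_fintype]
  refine ENNReal.sum_ne_top.2 fun i _ => ?_
  unfold sampleWeight
  split_ifs
  · exact ENNReal.ofReal_ne_top
  · exact ENNReal.zero_ne_top

open Classical in
/-- Sample `i ∈ R` with probability proportional to `xᵢ²` and return `R \ {i}`. If `x` vanishes on
`R`, there is nothing to sample and `R` is returned. -/
def unregularize {n : ℕ} (R : Finset (Fin n)) (x : E n) : PMF (Finset (Fin n)) :=
  if h : ∑' i, sampleWeight R x i ≠ 0 then
    (PMF.normalize (sampleWeight R x) h (tsum_sampleWeight_ne_top R x)).map fun i => R.erase i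
  else PMF.pure R

/-- The state of the core routine: the support set `S`, the set `R` of regularized indices and the
current solution `x`. -/
structure CoreState (n : ℕ) where
  S : Finset (Fin n)
  R : Finset (Fin n)
  x : E n

/-- One pass through the body of the loop of the core routine, after the test for an early return.
If the swap makes enough progress it is kept; otherwise a sampled index is unregularized. -/
def coreStep {n : ℕ} (f : E n → ℝ) (ρ : ℝ) (sel : Finset (Fin n) → (Fin n → ℝ) → Fin n)
    (s : ℕ) (opt : ℝ) (σ : CoreState n) : PMF (CoreState n) :=
  let g := regularized f ρ σ.R
  let i := sel Finset.univ fun k => |gradient g σ.x k|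
  let j := sel σ.S fun k => -|σ.x k|
  let S' := (insert i σ.S).erase j
  let x' := restrictedArgmin g S'
  if g σ.x - g x' < 1 / (s : ℝ) * (g σ.x - opt) then
    (unregularize σ.R σ.x).map fun R' =>
      ⟨σ.S, R', restrictedArgmin (regularized f ρ R') σ.S⟩
  else PMF.pure ⟨S', σ.R, x'⟩

/-- The loop of the core routine, with the given number of iterations left. -/
def coreLoop {n : ℕ} (f : E n → ℝ) (ρ : ℝ) (sel : Finset (Fin n) → (Fin n → ℝ) → Fin n)
    (s : ℕ) (opt : ℝ) : ℕ → CoreState n → PMF (E n)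
  | 0, σ => PMF.pure σ.x
  | k + 1, σ =>
    if f (restrictedArgmin f σ.S) ≤ opt then PMF.pure (restrictedArgmin f σ.S)
    else (coreStep f ρ sel s opt σ).bind (coreLoop f ρ sel s opt k)

/-- `ARHT_core(s, opt, ε)`, started at `R⁰ = [n]` and `S⁰ = [s]`, with
`2 s log ((f(0) - inf f) / ε)` iterations, rounded up. -/
def core {n : ℕ} (f : E n → ℝ) (ρ : ℝ) (sel : Finset (Fin n) → (Fin n → ℝ) → Fin n)
    (s : ℕ) (opt ε : ℝ) : PMF (E n) :=
  let S₀ : Finset (Fin n) := Finset.univ.filter fun i => (i : ℕ) < s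
  coreLoop f ρ sel s opt ⌈2 * (s : ℝ) * Real.log ((f 0 - ⨅ z, f z) / ε)⌉₊
    ⟨S₀, Finset.univ, restrictedArgmin (regularized f ρ Finset.univ) S₀⟩

/-- The loop of `ARHT_robust`: repeat `k` independent runs of `run` and keep the best of `xret` and
their outputs. -/
def robustLoop {n : ℕ} (f : E n → ℝ) (run : PMF (E n)) : ℕ → E n → PMF (E n)
  | 0, xret => PMF.pure xret
  | k + 1, xret => run.bind fun x => robustLoop f run k (if f x < f xret then x else xret)

/-- `ARHT_robust(s, opt, ε, B)`, with `5 log (6 n log ((f(0) - B) / ε))` repetitions, rounded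
up. -/
def robust {n : ℕ} (f : E n → ℝ) (ρ : ℝ) (sel : Finset (Fin n) → (Fin n → ℝ) → Fin n)
    (s : ℕ) (opt ε B : ℝ) : PMF (E n) :=
  robustLoop f (core f ρ sel s opt ε)
    ⌈5 * Real.log (6 * (n : ℝ) * Real.log ((f 0 - B) / ε))⌉₊ 0

/-- The binary search of `ARHT`: while `r - l > ε`, run `ARHT_robust` with the guess
`m = (l + r) / 2` and accuracy `ε / 3`. -/
def arhtLoop {n : ℕ} (f : E n → ℝ) (ρ : ℝ) (sel : Finset (Fin n) → (Fin n → ℝ) → Fin n)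
    (s : ℕ) (ε : ℝ) (hε : 0 < ε) (l r : ℝ) (b : E n) : PMF (E n) :=
  if h : ε < r - l then
    (robust f ρ sel s ((l + r) / 2) (ε / 3) (⨅ z, f z)).bind fun x =>
      if hx : (l + r) / 2 + ε / 3 < f x then arhtLoop f ρ sel s ε hε ((l + r) / 2) r b
      else arhtLoop f ρ sel s ε hε l (f x) x
  else PMF.pure b
termination_by ⌈6 * (r - l) / ε⌉₊
decreasing_by
  all_goals
    have key : ∀ u : ℝ, u ≤ (r - l) - ε / 6 → ⌈6 * u / ε⌉₊ < ⌈6 * (r - l) / ε⌉₊ := by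
      intro u hu
      have h1 : 6 * u / ε + 1 ≤ 6 * (r - l) / ε := by
        rw [← sub_nonneg]
        have : 6 * (r - l) / ε - (6 * u / ε + 1) = 6 * ((r - l) - ε / 6 - u) / ε := by
          field_simp
          ring
        rw [this]
        exact div_nonneg (by linarith) hε.le
      have h2 : (6 : ℝ) < 6 * (r - l) / ε := by
        rw [lt_div_iff₀ hε]
        linarith
      rcases le_or_gt (6 * u / ε) 0 with h0 | h0
      · rw [Nat.ceil_eq_zero.2 h0]
        exact Nat.ceil_pos.2 (by linarith)
      · have h3 := Nat.ceil_lt_add_one h0.le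
        have h4 := Nat.le_ceil (6 * (r - l) / ε)
        exact_mod_cast h3.trans_le (h1.trans h4)
    apply key
    linarith

/-- `ARHT(s, ε)` applied to `f`: the law of the (random) output. Here `ρ` is the parameter of the
regularizer. -/
def arht {n : ℕ} (f : E n → ℝ) (ρ : ℝ) (sel : Finset (Fin n) → (Fin n → ℝ) → Fin n)
    (s : ℕ) (ε : ℝ) (hε : 0 < ε) : PMF (E n) :=
  arhtLoop f ρ sel s ε hε (⨅ z, f z) (f 0) 0

end ARHT

end

/-!
Two measures of progress compete in the core routine. A swap that is accepted shrinks the gap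
between the regularized objective and `opt` by the factor `1 - 1 / s`. If a swap is rejected, then
the gradient step along the new coordinate gains too little compared with the loss from deleting
the smallest entry (`swap_decrease`). Restricted strong convexity towards a feasible point `z`
(`regularized_gap_le`) turns this into a statement about the regularized entries of the current
solution, where `κ = ρ⁺ / ρ⁻`: their mass on the support of `z` is at least a fraction
`1 / (2 κ + 3)` of the total, as long as at most `(4 κ + 6) s*` indices outside `supp z` have been
unregularized (`mass_lt_of_no_progress`). Hence the index sampled next lies in `supp z` with odds
at least `1 : 2 (κ + 1)`, and this can happen at most `s*` times.

So the number of unregularized indices outside `supp z`, plus `2 (κ + 1)` times the number of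
regularized indices in `supp z`, is a potential that does not increase in expectation. It starts
at most at `2 (κ + 1) s*`, and Markov's inequality bounds the probability that it reaches
`(4 κ + 6) s*` by one half. Otherwise at most `(4 κ + 7) s* ≤ s` iterations are spent on
unregularizing, the other iterations are accepted swaps, and there are enough of them to reduce
the gap to `ε` (`toOuterMeasure_coreLoop_le`, `toOuterMeasure_core_le`).

Independent repetition makes the failure probability of a single guess at most
`1 / (6 n log (3 D / ε))` with `D = f 0 - inf f`, and a union bound over the binary search, whose
interval shrinks by the factor `5 / 6` in each step, gives failure probability at most `1 / n`
(`toOuterMeasure_arht_le`). Finally, restricted strong convexity at `x*` converts the bound on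
`f x - f x*` into a quadratic inequality for `‖x - x*‖`.
-/

namespace ARHT

variable {n : ℕ}

/-! ### Coordinates and supports -/

lemma mem_supp {x : E n} {i : Fin n} : i ∈ supp x ↔ x i ≠ 0 := by
  simp [supp]

lemma supp_subset_iff {x : E n} {S : Finset (Fin n)} : supp x ⊆ S ↔ ∀ i, i ∉ S → x i = 0 := by
  constructor
  · intro h i hi
    by_contra h0
    exact hi (h (mem_supp.2 h0))
  · intro h i hi
    by_contra h0
    exact mem_supp.1 hi (h i h0)

lemma isSparse_of_supp_subset {x : E n} {S : Finset (Fin n)} {k : ℕ} (h : supp x ⊆ S)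
    (hS : S.card ≤ k) : IsSparse k x :=
  (Finset.card_le_card h).trans hS

lemma isSparse_zero (k : ℕ) : IsSparse k (0 : E n) := by
  simp [IsSparse, supp]

lemma supp_sub_subset (x y : E n) : supp (y - x) ⊆ supp y ∪ supp x := by
  rw [supp_subset_iff]
  intro i hi
  simp only [Finset.mem_union, mem_supp, not_or, not_not] at hi
  simp [hi.1, hi.2]

lemma IsSparse.sub {k l : ℕ} {x y : E n} (hy : IsSparse k y) (hx : IsSparse l x) :
    IsSparse (k + l) (y - x) :=
  isSparse_of_supp_subset (supp_sub_subset x y)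
    ((Finset.card_union_le _ _).trans (Nat.add_le_add hy hx))

lemma inner_eq_sum (x y : E n) : inner ℝ x y = ∑ i, x i * y i := by
  simp [PiLp.inner_apply, mul_comm]

lemma norm_restrict_sq (x : E n) (R : Finset (Fin n)) :
    ‖restrict x R‖ ^ 2 = ∑ i, if i ∈ R then x i ^ 2 else 0 := by
  rw [EuclideanSpace.real_norm_sq_eq]
  refine Finset.sum_congr rfl fun i _ => ?_
  by_cases h : i ∈ R <;> simp [restrict, h]

lemma norm_restrict_le (x : E n) (R : Finset (Fin n)) : ‖restrict x R‖ ≤ ‖x‖ := by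
  refine le_of_sq_le_sq ?_ (norm_nonneg x)
  rw [norm_restrict_sq, EuclideanSpace.real_norm_sq_eq]
  refine Finset.sum_le_sum fun i _ => ?_
  split_ifs
  · exact le_rfl
  · positivity

/-- Restriction to `R` as a continuous linear map. -/
noncomputable def restrictCLM (R : Finset (Fin n)) : E n →L[ℝ] E n :=
  LinearMap.toContinuousLinearMap
    { toFun := fun x => restrict x R
      map_add' := fun x y => by
        ext i
        by_cases h : i ∈ R <;> simp [restrict, h]
      map_smul' := fun c x => by
        ext i
        by_cases h : i ∈ R <;> simp [restrict, h] }

lemma restrictCLM_apply (R : Finset (Fin n)) (x : E n) : restrictCLM R x = restrict x R := rfl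

/-! ### Restricted smoothness and convexity -/

/-- `f` satisfies the upper quadratic bound with constant `ρ` along `k`-sparse differences. -/
def RestrictedSmooth (f : E n → ℝ) (k : ℕ) (ρ : ℝ) : Prop :=
  ∀ x y : E n, IsSparse k (y - x) →
    f y ≤ f x + inner ℝ (gradient f x) (y - x) + ρ / 2 * ‖y - x‖ ^ 2

/-- `f` satisfies the lower quadratic bound with constant `ρ` along `k`-sparse differences. -/
def RestrictedConvex (f : E n → ℝ) (k : ℕ) (ρ : ℝ) : Prop :=
  ∀ x y : E n, IsSparse k (y - x) →
    f x + inner ℝ (gradient f x) (y - x) + ρ / 2 * ‖y - x‖ ^ 2 ≤ f y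

lemma supp_single_subset (i : Fin n) (a : ℝ) : supp (EuclideanSpace.single i a) ⊆ {i} := by
  rw [supp_subset_iff]
  intro k hk
  simp only [Finset.mem_singleton] at hk
  simp [hk]

/-- Comparing both quadratic bounds along a coordinate direction: the condition number is at
least one. -/
lemma RestrictedConvex.le_of_restrictedSmooth {f : E n → ℝ} {k l : ℕ} {ρm ρp : ℝ}
    (hm : RestrictedConvex f k ρm) (hp : RestrictedSmooth f l ρp) (hk : 1 ≤ k) (hl : 1 ≤ l)
    (hn : 0 < n) : ρm ≤ ρp := by
  have hsp := supp_single_subset (⟨0, hn⟩ : Fin n) (1 : ℝ)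
  have h1 := hm 0 (EuclideanSpace.single ⟨0, hn⟩ 1)
    (by rw [sub_zero]; exact isSparse_of_supp_subset hsp (by simpa using hk))
  have h2 := hp 0 (EuclideanSpace.single ⟨0, hn⟩ 1)
    (by rw [sub_zero]; exact isSparse_of_supp_subset hsp (by simpa using hl))
  have h3 : ‖(EuclideanSpace.single ⟨0, hn⟩ 1 : E n) - 0‖ = 1 := by simp
  rw [h3] at h1 h2
  linarith

/-! ### The regularized objective -/

lemma hasGradientAt_regularized {f : E n → ℝ} (hf : Differentiable ℝ f) (ρ : ℝ)
    (R : Finset (Fin n)) (x : E n) :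
    HasGradientAt (regularized f ρ R) (gradient f x + ρ • restrict x R) x := by
  have h1 := (hf x).hasGradientAt.hasFDerivAt
  have h2 := ((restrictCLM R).hasFDerivAt (x := x)).norm_sq.const_mul (ρ / 2)
  rw [hasGradientAt_iff_hasFDerivAt]
  refine (h1.add h2).congr_fderiv ?_
  ext v
  simp only [restrictCLM_apply, map_add, map_smul, add_apply,
    smul_apply, ContinuousLinearMap.comp_apply, innerSL_apply_apply,
    InnerProductSpace.toDual_apply_apply, inner_eq_sum, smul_eq_mul, nsmul_eq_mul]
  congr 1
  have : ∑ i, restrict x R i * restrict v R i = ∑ i, restrict x R i * v i := by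
    refine Finset.sum_congr rfl fun i _ => ?_
    by_cases h : i ∈ R <;> simp [restrict, h]
  rw [this]
  push_cast
  ring

lemma differentiable_regularized {f : E n → ℝ} (hf : Differentiable ℝ f) (ρ : ℝ)
    (R : Finset (Fin n)) : Differentiable ℝ (regularized f ρ R) :=
  fun x => (hasGradientAt_regularized hf ρ R x).hasFDerivAt.differentiableAt

lemma gradient_regularized_apply {f : E n → ℝ} (hf : Differentiable ℝ f) (ρ : ℝ)
    (R : Finset (Fin n)) (x : E n) (k : Fin n) :
    gradient (regularized f ρ R) x k = gradient f x k + if k ∈ R then ρ * x k else 0 := by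
  rw [(hasGradientAt_regularized hf ρ R x).gradient]
  by_cases h : k ∈ R <;> simp [restrict, h]

lemma le_regularized {f : E n → ℝ} {ρ : ℝ} (hρ : 0 ≤ ρ) (R : Finset (Fin n)) (x : E n) :
    f x ≤ regularized f ρ R x := by
  unfold regularized
  have : 0 ≤ ρ / 2 * ‖restrict x R‖ ^ 2 := by positivity
  linarith

lemma regularized_zero (f : E n → ℝ) (ρ : ℝ) (R : Finset (Fin n)) :
    regularized f ρ R 0 = f 0 := by
  have : restrict (0 : E n) R = 0 := (restrictCLM R).map_zero
  simp [regularized, this]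

lemma regularized_empty (f : E n → ℝ) (ρ : ℝ) : regularized f ρ ∅ = f := by
  funext x
  simp [regularized, norm_restrict_sq]

lemma regularized_mono {f : E n → ℝ} {ρ : ℝ} (hρ : 0 ≤ ρ) {R R' : Finset (Fin n)}
    (h : R' ⊆ R) (x : E n) : regularized f ρ R' x ≤ regularized f ρ R x := by
  unfold regularized
  rw [norm_restrict_sq, norm_restrict_sq]
  gcongr with i
  split_ifs with h1 h2 h2
  · exact le_rfl
  · exact absurd (h h1) h2
  · positivity
  · exact le_rfl

/-- The regularizer has curvature at most `ρ`, so the smoothness constants add up. -/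
lemma RestrictedSmooth.regularized {f : E n → ℝ} (hf : Differentiable ℝ f) {k : ℕ} {ρ : ℝ}
    (hρ : 0 ≤ ρ) (h : RestrictedSmooth f k ρ) (R : Finset (Fin n)) :
    RestrictedSmooth (regularized f ρ R) k (2 * ρ) := by
  intro x y hxy
  have h1 := h x y hxy
  rw [(hasGradientAt_regularized hf ρ R x).gradient, inner_add_left, real_inner_smul_left]
  have h2 : ‖restrict y R‖ ^ 2
      = ‖restrict x R‖ ^ 2 + 2 * inner ℝ (restrict x R) (y - x) + ‖restrict (y - x) R‖ ^ 2 := by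
    rw [norm_restrict_sq, norm_restrict_sq, norm_restrict_sq, inner_eq_sum, Finset.mul_sum,
      ← Finset.sum_add_distrib, ← Finset.sum_add_distrib]
    refine Finset.sum_congr rfl fun i _ => ?_
    by_cases hi : i ∈ R
    · simp [restrict, hi]
      ring
    · simp [restrict, hi]
  have h3 : ρ / 2 * ‖restrict (y - x) R‖ ^ 2 ≤ ρ / 2 * ‖y - x‖ ^ 2 := by
    gcongr
    exact norm_restrict_le _ _
  simp only [ARHT.regularized]
  rw [h2]
  linarith

/-! ### Restricted minimizers -/

lemma supp_restrictedArgmin_subset (f : E n → ℝ) (S : Finset (Fin n)) :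
    supp (restrictedArgmin f S) ⊆ S := by
  unfold restrictedArgmin
  split_ifs with h
  · exact h.choose_spec.1
  · simp [supp]

lemma isRestrictedMinimizer_restrictedArgmin {f : E n → ℝ} {S : Finset (Fin n)}
    (h : ∃ x, IsRestrictedMinimizer f S x) :
    IsRestrictedMinimizer f S (restrictedArgmin f S) := by
  unfold restrictedArgmin
  rw [dif_pos h]
  exact h.choose_spec

lemma isClosed_supp_subset (S : Finset (Fin n)) : IsClosed {x : E n | supp x ⊆ S} := by
  simp only [supp_subset_iff, Set.ofPred_forall]
  refine isClosed_iInter fun i => isClosed_iInter fun _ => ?_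
  exact isClosed_eq (by fun_prop) continuous_const

/-- The lower quadratic bound at the origin makes `f`, and every continuous function above `f`,
coercive on the vectors supported in `S`, so that minimizers exist. -/
lemma exists_isRestrictedMinimizer {f g : E n → ℝ} {k : ℕ} {ρ : ℝ} (hρ : 0 < ρ)
    (hc : RestrictedConvex f k ρ) (hg : Continuous g) (hfg : ∀ x, f x ≤ g x)
    {S : Finset (Fin n)} (hS : S.card ≤ k) : ∃ x, IsRestrictedMinimizer g S x := by
  have hev : ∀ᶠ x in Filter.cocompact (E n) ⊓ Filter.principal {x | supp x ⊆ S}, g 0 ≤ g x := by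
    rw [Filter.eventually_inf_principal]
    have h1 : Filter.Tendsto (fun x : E n => ‖x‖) (Filter.cocompact (E n)) Filter.atTop :=
      tendsto_norm_cocompact_atTop
    set G := ‖gradient f 0‖
    have h2 : Filter.Tendsto (fun t : ℝ => f 0 + t * (ρ / 2 * t - G)) Filter.atTop
        Filter.atTop := by
      refine Filter.tendsto_atTop_add_const_left _ _ ?_
      refine Filter.Tendsto.atTop_mul_atTop₀ Filter.tendsto_id ?_
      exact Filter.tendsto_atTop_add_const_right _ _
        (Filter.Tendsto.const_mul_atTop (by positivity) Filter.tendsto_id)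
    filter_upwards [(h2.comp h1).eventually_ge_atTop (g 0)] with x hx hxS
    have h3 := hc 0 x (by rw [sub_zero]; exact isSparse_of_supp_subset hxS hS)
    rw [sub_zero] at h3
    have h4 := neg_le_of_abs_le (abs_real_inner_le_norm (gradient f 0) x)
    have h5 := hfg x
    simp only [Function.comp] at hx
    nlinarith
  obtain ⟨x, hx, hmin⟩ := hg.continuousOn.exists_isMinOn' (isClosed_supp_subset S)
    (x₀ := 0) (by simp [supp]) hev
  exact ⟨x, hx, fun y hy => hmin hy⟩

/-- First-order optimality on the support. -/
lemma IsRestrictedMinimizer.gradient_apply_eq_zero {g : E n → ℝ} (hg : Differentiable ℝ g)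
    {S : Finset (Fin n)} {x : E n} (hx : IsRestrictedMinimizer g S x) {k : Fin n} (hk : k ∈ S) :
    gradient g x k = 0 := by
  set e : E n := EuclideanSpace.single k 1
  have hline : HasDerivAt (fun t : ℝ => x + t • e) e 0 := by
    simpa using ((hasDerivAt_id (0 : ℝ)).smul_const e).const_add x
  have hg' : HasFDerivAt g (InnerProductSpace.toDual ℝ (E n) (gradient g x)) (x + (0 : ℝ) • e) := by
    simpa using (hg x).hasGradientAt.hasFDerivAt
  have hd := hg'.comp_hasDerivAt (0 : ℝ) hline
  have hmin : IsLocalMin (g ∘ fun t : ℝ => x + t • e) 0 := by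
    refine Filter.Eventually.of_forall fun t => ?_
    have : supp (x + t • e) ⊆ S := by
      rw [supp_subset_iff]
      intro i hi
      have hik : i ≠ k := fun h => hi (h ▸ hk)
      simp [e, supp_subset_iff.1 hx.1 i hi, hik]
    simpa using hx.2 _ this
  have h0 := hmin.hasDerivAt_eq_zero hd
  rw [InnerProductSpace.toDual_apply_apply, EuclideanSpace.inner_single_right] at h0
  simpa using h0

/-! ### The swap step -/

/-- The index that the swap adds to the support: a largest entry of the gradient. -/
noncomputable def swapIn (sel : Finset (Fin n) → (Fin n → ℝ) → Fin n) (g : E n → ℝ)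
    (x : E n) : Fin n :=
  sel Finset.univ fun k => |gradient g x k|

/-- The index that the swap removes from the support `S`: a smallest entry of `x` on `S`. -/
noncomputable def swapOut (sel : Finset (Fin n) → (Fin n → ℝ) → Fin n) (S : Finset (Fin n))
    (x : E n) : Fin n :=
  sel S fun k => -|x k|

/-- The support after the swap. -/
noncomputable def swapSupport (sel : Finset (Fin n) → (Fin n → ℝ) → Fin n) (g : E n → ℝ)
    (S : Finset (Fin n)) (x : E n) : Finset (Fin n) :=
  (insert (swapIn sel g x) S).erase (swapOut sel S x)

lemma abs_gradient_le_swapIn {sel : Finset (Fin n) → (Fin n → ℝ) → Fin n} (hsel : IsArgmaxRule sel)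
    (g : E n → ℝ) (x : E n) (k : Fin n) : |gradient g x k| ≤ |gradient g x (swapIn sel g x)| :=
  (hsel Finset.univ (fun k => |gradient g x k|) ⟨k, Finset.mem_univ k⟩).2 k (Finset.mem_univ k)

lemma swapOut_mem {sel : Finset (Fin n) → (Fin n → ℝ) → Fin n} (hsel : IsArgmaxRule sel)
    {S : Finset (Fin n)} (hS : S.Nonempty) (x : E n) : swapOut sel S x ∈ S :=
  (hsel S (fun k => -|x k|) hS).1

lemma sq_swapOut_le {sel : Finset (Fin n) → (Fin n → ℝ) → Fin n} (hsel : IsArgmaxRule sel)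
    {S : Finset (Fin n)} (x : E n) {k : Fin n} (hk : k ∈ S) : x (swapOut sel S x) ^ 2 ≤ x k ^ 2 := by
  have h := (hsel S (fun k => -|x k|) ⟨k, hk⟩).2 k hk
  exact sq_le_sq.2 (neg_le_neg_iff.1 h)

lemma card_swapSupport_le {sel : Finset (Fin n) → (Fin n → ℝ) → Fin n} (hsel : IsArgmaxRule sel)
    (g : E n → ℝ) {S : Finset (Fin n)} (hS : S.Nonempty) (x : E n) :
    (swapSupport sel g S x).card ≤ S.card := by
  have h := swapOut_mem hsel hS x
  rw [swapSupport, Finset.card_erase_of_mem (Finset.mem_insert_of_mem h)]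
  have := Finset.card_insert_le (swapIn sel g x) S
  omega

/-- The decrease achieved by the swap, from a single gradient step along the new coordinate and
the removal of the smallest entry. The gradient vanishes on `S`, so the removal costs only a
quadratic term; the same bound holds trivially if the new coordinate lies in `S`, for then the whole
gradient vanishes. -/
lemma swap_decrease {g : E n → ℝ} (hg : Differentiable ℝ g) {ρ : ℝ} (hρ : 0 < ρ)
    (hsm : RestrictedSmooth g 2 (2 * ρ))
    {sel : Finset (Fin n) → (Fin n → ℝ) → Fin n} (hsel : IsArgmaxRule sel)
    {S : Finset (Fin n)} (hS : S.Nonempty) {x x' : E n} (hx : IsRestrictedMinimizer g S x)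
    (hx' : IsRestrictedMinimizer g (swapSupport sel g S x) x') :
    g x' ≤ g x - gradient g x (swapIn sel g x) ^ 2 / (4 * ρ) + ρ * x (swapOut sel S x) ^ 2 := by
  set i := swapIn sel g x
  set j := swapOut sel S x
  have hjS : j ∈ S := swapOut_mem hsel hS x
  have hgj : gradient g x j = 0 := hx.gradient_apply_eq_zero hg hjS
  by_cases hiS : i ∈ S
  · have hgi : gradient g x i = 0 := hx.gradient_apply_eq_zero hg hiS
    set d : E n := EuclideanSpace.single j (-(x j)) with hd
    have hsub : supp (x + d) ⊆ swapSupport sel g S x := by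
      rw [supp_subset_iff]
      intro k hk
      by_cases hkj : k = j
      · simp [hd, hkj]
      · have hkS : k ∉ S := fun h => hk
          (Finset.mem_erase.2 ⟨hkj, Finset.mem_insert_of_mem h⟩)
        simp [hd, supp_subset_iff.1 hx.1 k hkS, hkj]
    have h1 := hsm x (x + d) (by
      rw [add_sub_cancel_left]
      exact isSparse_of_supp_subset (supp_single_subset j _) (by simp))
    rw [add_sub_cancel_left, hd, EuclideanSpace.inner_single_right] at h1
    have h2 := hx'.2 _ hsub
    simp only [hgj, PiLp.norm_single, norm_neg, Real.norm_eq_abs, sq_abs] at h1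
    simp only [map_zero, mul_zero] at h1
    rw [hgi, zero_pow two_ne_zero, zero_div]
    rw [hd] at h2
    linarith
  · have hij : i ≠ j := fun h => hiS (h ▸ hjS)
    -- The step `η` minimizes the quadratic upper bound along coordinate `i`.
    set η : ℝ := -(gradient g x i) / (2 * ρ) with hη
    set d : E n := EuclideanSpace.single i η + EuclideanSpace.single j (-(x j)) with hd
    have hxi : x i = 0 := supp_subset_iff.1 hx.1 i hiS
    have hsub : supp (x + d) ⊆ swapSupport sel g S x := by
      rw [supp_subset_iff]
      intro k hk
      by_cases hkj : k = j
      · simp [hd, hkj, hij.symm]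
      · have hki : k ≠ i := fun h => hk
          (Finset.mem_erase.2 ⟨hkj, h ▸ Finset.mem_insert_self _ _⟩)
        have hkS : k ∉ S := fun h => hk
          (Finset.mem_erase.2 ⟨hkj, Finset.mem_insert_of_mem h⟩)
        simp [hd, supp_subset_iff.1 hx.1 k hkS, hkj, hki]
    have hdsp : supp d ⊆ {i, j} := by
      rw [supp_subset_iff]
      intro k hk
      simp only [Finset.mem_insert, Finset.mem_singleton, not_or] at hk
      simp [hd, hk.1, hk.2]
    have h1 := hsm x (x + d) (by
      rw [add_sub_cancel_left]
      exact isSparse_of_supp_subset hdsp Finset.card_le_two)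
    have hnorm : ‖d‖ ^ 2 = η ^ 2 + x j ^ 2 := by
      rw [hd, norm_add_sq_real, EuclideanSpace.inner_single_right]
      simp [PiLp.norm_single, hij.symm]
    rw [add_sub_cancel_left, hnorm, hd, inner_add_right, EuclideanSpace.inner_single_right,
      EuclideanSpace.inner_single_right, hgj] at h1
    have h2 := hx'.2 _ hsub
    rw [hd] at h2
    simp only [map_zero, mul_zero, add_zero, conj_trivial] at h1
    have h3 : η * gradient g x i + 2 * ρ / 2 * (η ^ 2 + x j ^ 2)
        = -(gradient g x i ^ 2 / (4 * ρ)) + ρ * x j ^ 2 := by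
      rw [hη]
      field_simp
      ring
    linarith

/-- Restricted strong convexity towards `z`, expressed through the regularized objective. The inner
product and the quadratic terms are compared coordinate by coordinate: off the support of `x` by
completing the square against the gradient, on it by completing the square against the
regularizer. -/
lemma regularized_gap_le {f : E n → ℝ} (hf : Differentiable ℝ f) {ρp ρm : ℝ} (hm : 0 < ρm)
    (hmp : ρm ≤ ρp) {k : ℕ} (hc : RestrictedConvex f k ρm) {R S : Finset (Fin n)} {x z : E n}
    (hx : IsRestrictedMinimizer (regularized f ρp R) S x) (hsp : IsSparse k (z - x)) :
    regularized f ρp R x - f z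
        + ρp / 2 * (∑ i ∈ R \ supp z, x i ^ 2 - (1 + ρp / ρm) * ∑ i ∈ R ∩ supp z, x i ^ 2)
      ≤ (∑ i ∈ supp z \ S, gradient (regularized f ρp R) x i ^ 2) / (2 * ρm) := by
  have h1 := hc x z hsp
  have hp : 0 < ρp := hm.trans_le hmp
  have key : ∀ i : Fin n,
      (if i ∈ R then ρp / 2 * x i ^ 2 else 0)
          + (if i ∈ R \ supp z then ρp / 2 * x i ^ 2 else 0)
          - (if i ∈ R ∩ supp z then ρp / 2 * (1 + ρp / ρm) * x i ^ 2 else 0)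
        ≤ (gradient f x i * (z - x) i + ρm / 2 * (z - x) i ^ 2)
          + (if i ∈ supp z \ S then gradient (regularized f ρp R) x i ^ 2 / (2 * ρm) else 0) := by
    intro i
    have hG := gradient_regularized_apply hf ρp R x i
    set G := gradient (regularized f ρp R) x i
    have hGf : gradient f x i = G - if i ∈ R then ρp * x i else 0 := by rw [hG]; ring
    rw [hGf]
    simp only [PiLp.sub_apply]
    by_cases hiS : i ∈ S
    · have hG0 : G = 0 := hx.gradient_apply_eq_zero (differentiable_regularized hf ρp R) hiS
      by_cases hiR : i ∈ R
      · by_cases hiz : i ∈ supp z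
        · simp only [hiR, hiz, hiS, hG0, Finset.mem_sdiff, Finset.mem_inter, not_true, and_false,
            and_self, if_true, if_false]
          have : 0 ≤ ρm / 2 * ((z i - x i) - ρp / ρm * x i) ^ 2 := by positivity
          have h2 : ρm / 2 * ((z i - x i) - ρp / ρm * x i) ^ 2
              = ρm / 2 * (z i - x i) ^ 2 - ρp * x i * (z i - x i)
                + ρp / 2 * (ρp / ρm) * x i ^ 2 := by
            field_simp
            ring
          linarith
        · have hz0 : z i = 0 := by simpa [mem_supp] using hiz
          simp only [hiR, hiz, hiS, hG0, hz0, Finset.mem_sdiff, Finset.mem_inter, not_true,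
            and_false, not_false_iff, and_self, if_true, if_false]
          nlinarith [mul_nonneg hm.le (sq_nonneg (x i))]
      · simp only [hiR, hiS, hG0, Finset.mem_sdiff, Finset.mem_inter, not_true, and_false,
          false_and, if_false]
        have : 0 ≤ ρm / 2 * (z i - x i) ^ 2 := by positivity
        linarith
    · have hx0 : x i = 0 := supp_subset_iff.1 hx.1 i hiS
      by_cases hiz : i ∈ supp z
      · simp only [hx0, hiz, hiS, Finset.mem_sdiff, not_false_iff, and_self, if_true]
        have : 0 ≤ (ρm * z i + G) ^ 2 / (2 * ρm) := by positivity
        have h2 : (ρm * z i + G) ^ 2 / (2 * ρm)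
            = G * z i + ρm / 2 * z i ^ 2 + G ^ 2 / (2 * ρm) := by
          field_simp
          ring
        simp
        linarith
      · have hz0 : z i = 0 := by simpa [mem_supp] using hiz
        simp [hx0, hz0, hiz]
  have hsum := Finset.sum_le_sum fun i (_ : i ∈ Finset.univ) => key i
  simp only [Finset.sum_add_distrib, Finset.sum_sub_distrib, ← Finset.sum_filter,
    Finset.filter_mem_eq_inter, Finset.univ_inter, ← Finset.mul_sum, ← Finset.sum_div] at hsum
  rw [inner_eq_sum, EuclideanSpace.real_norm_sq_eq] at h1
  have hR : regularized f ρp R x = f x + ρp / 2 * ∑ i ∈ R, x i ^ 2 := by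
    rw [regularized, norm_restrict_sq, ← Finset.sum_filter, Finset.filter_mem_eq_inter,
      Finset.univ_inter]
  rw [hR]
  linarith

/-- If a swap makes too little progress towards a value `opt ≥ f z`, then the regularized part of
`x` has a substantial share of its mass on the support of `z`. The hypothesis `hq` says that enough
regularized indices outside `supp z` are left in the support of `x`, which makes the entry that the
swap removes small. -/
lemma mass_lt_of_no_progress {f : E n → ℝ} (hf : Differentiable ℝ f) {ρp ρm : ℝ} (hm : 0 < ρm)
    (hmp : ρm ≤ ρp) (hsm : RestrictedSmooth f 2 ρp) {k : ℕ} (hc : RestrictedConvex f k ρm)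
    {sel : Finset (Fin n) → (Fin n → ℝ) → Fin n} (hsel : IsArgmaxRule sel)
    {R S : Finset (Fin n)} {x x' z : E n} {s opt : ℝ}
    (hx : IsRestrictedMinimizer (regularized f ρp R) S x) (hsp : IsSparse k (z - x))
    (hx' : IsRestrictedMinimizer (regularized f ρp R)
      (swapSupport sel (regularized f ρp R) S x) x')
    (hopt : f z ≤ opt) (hgap : opt ≤ regularized f ρp R x)
    (hno : regularized f ρp R x - regularized f ρp R x' < 1 / s * (regularized f ρp R x - opt))
    (hmis : 0 < (supp z \ S).card)
    (hs : 2 * (ρp / ρm) * ((supp z \ S).card : ℝ) ≤ s)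
    (hq : 8 * (ρp / ρm) * ((supp z \ S).card : ℝ) ≤ (((S ∩ R) \ supp z).card : ℝ)) :
    ∑ i ∈ R \ supp z, x i ^ 2 < 2 * (ρp / ρm + 1) * ∑ i ∈ R ∩ supp z, x i ^ 2 := by
  have hp : 0 < ρp := hm.trans_le hmp
  set g := regularized f ρp R with hg
  set m : ℝ := ((supp z \ S).card : ℝ) with hmdef
  set q : ℝ := (((S ∩ R) \ supp z).card : ℝ) with hqdef
  set κ := ρp / ρm with hκ
  have hκ0 : 0 < κ := div_pos hp hm
  have hm0 : 0 < m := Nat.cast_pos.2 hmis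
  have hs0 : 0 < s := lt_of_lt_of_le (by positivity) hs
  have hq0 : 0 < q := lt_of_lt_of_le (by positivity) hq
  have hSne : S.Nonempty := by
    have h : 0 < ((S ∩ R) \ supp z).card := Nat.cast_pos.1 hq0
    obtain ⟨i, hi⟩ := Finset.card_pos.1 h
    exact ⟨i, (Finset.mem_inter.1 (Finset.mem_sdiff.1 hi).1).1⟩
  have hdec := swap_decrease (differentiable_regularized hf ρp R) hp (hsm.regularized hf hp.le R)
    hsel hSne hx hx'
  have hgapz := regularized_gap_le hf hm hmp hc hx hsp
  rw [← hg] at hdec hgapz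
  set b := ∑ i ∈ R \ supp z, x i ^ 2
  set a := ∑ i ∈ R ∩ supp z, x i ^ 2
  set G := gradient g x (swapIn sel g x)
  set y := x (swapOut sel S x)
  have hGm : ∑ i ∈ supp z \ S, gradient g x i ^ 2 ≤ m * G ^ 2 := by
    have := Finset.sum_le_card_nsmul (supp z \ S) (fun i => gradient g x i ^ 2) (G ^ 2)
      fun i _ => sq_le_sq.2 (abs_gradient_le_swapIn hsel g x i)
    simpa [nsmul_eq_mul] using this
  have hyb : q * y ^ 2 ≤ b := by
    have h1 := Finset.card_nsmul_le_sum ((S ∩ R) \ supp z) (fun i => x i ^ 2) (y ^ 2)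
      fun i hi => sq_swapOut_le hsel x (Finset.mem_inter.1 (Finset.mem_sdiff.1 hi).1).1
    have h2 : ∑ i ∈ (S ∩ R) \ supp z, x i ^ 2 ≤ b :=
      Finset.sum_le_sum_of_subset_of_nonneg
        (Finset.sdiff_subset_sdiff Finset.inter_subset_right le_rfl) fun i _ _ => sq_nonneg _
    rw [nsmul_eq_mul] at h1
    exact h1.trans h2
  set Δ := g x - opt with hΔ
  have hΔ0 : 0 ≤ Δ := sub_nonneg.2 hgap
  have h1 : G ^ 2 / (4 * ρp) < 1 / s * Δ + ρp * y ^ 2 := by linarith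
  have h2 : Δ + ρp / 2 * (b - (1 + κ) * a) ≤ 2 * κ * m * (G ^ 2 / (4 * ρp)) := by
    have e : 2 * κ * m * (G ^ 2 / (4 * ρp)) = m * G ^ 2 / (2 * ρm) := by
      rw [hκ]
      field_simp
      ring
    have e2 : (∑ i ∈ supp z \ S, gradient g x i ^ 2) / (2 * ρm) ≤ m * G ^ 2 / (2 * ρm) := by
      gcongr
    linarith
  -- After multiplication by `2 κ m`, the gap cancels because `2 κ m ≤ s`, and the cost of the
  -- removal is at most a quarter of `ρp b` because `8 κ m ≤ q`.
  have h3 : 2 * κ * m * (1 / s * Δ) ≤ Δ := by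
    have : 2 * κ * m * (1 / s) ≤ 1 := by
      rw [mul_one_div, div_le_one hs0]
      exact hs
    calc 2 * κ * m * (1 / s * Δ) = 2 * κ * m * (1 / s) * Δ := by ring
      _ ≤ 1 * Δ := by gcongr
      _ = Δ := one_mul _
  have h4 : 2 * κ * m * (ρp * y ^ 2) ≤ ρp * b / 4 := by
    have : 8 * κ * m * y ^ 2 ≤ b := (mul_le_mul_of_nonneg_right hq (sq_nonneg y)).trans hyb
    nlinarith
  have h5 : 2 * κ * m * (G ^ 2 / (4 * ρp)) < 2 * κ * m * (1 / s * Δ + ρp * y ^ 2) := by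
    gcongr
  have h6 : ρp * b < ρp * (2 * (κ + 1) * a) := by linarith
  exact lt_of_mul_lt_mul_left h6 hp.le

/-! ### Probabilities of events under `PMF` -/

lemma toOuterMeasure_le_one {α : Type*} (p : PMF α) (A : Set α) : p.toOuterMeasure A ≤ 1 := by
  have h : p.toOuterMeasure Set.univ = 1 :=
    (p.toOuterMeasure_apply_eq_one_iff _).2 (Set.subset_univ _)
  exact h ▸ p.toOuterMeasure.mono (Set.subset_univ A)

lemma toOuterMeasure_eq_zero_of_forall {α : Type*} {p : PMF α} {A : Set α}
    (h : ∀ a ∈ p.support, a ∉ A) : p.toOuterMeasure A = 0 :=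
  (p.toOuterMeasure_apply_eq_zero_iff A).2 (Set.disjoint_left.2 h)

lemma toOuterMeasure_pure_of_notMem {α : Type*} {a : α} {A : Set α} (h : a ∉ A) :
    (PMF.pure a).toOuterMeasure A = 0 := by
  rw [PMF.toOuterMeasure_pure_apply, if_neg h]

/-- Union bound for a composite experiment: it fails only if the first stage lands in `A` or the
second stage fails from a starting point outside `A`. -/
lemma toOuterMeasure_bind_le {α β : Type*} (p : PMF α) (k : α → PMF β) (A : Set α) (B : Set β)
    (c : ENNReal) (h : ∀ a ∈ p.support, a ∉ A → (k a).toOuterMeasure B ≤ c) :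
    (p.bind k).toOuterMeasure B ≤ p.toOuterMeasure A + c := by
  rw [PMF.toOuterMeasure_bind_apply, PMF.toOuterMeasure_apply]
  calc ∑' a, p a * (k a).toOuterMeasure B
      ≤ ∑' a, (A.indicator (⇑p) a + p a * c) := by
        refine ENNReal.tsum_le_tsum fun a => ?_
        by_cases ha : a ∈ A
        · rw [Set.indicator_of_mem ha]
          exact (mul_le_of_le_one_right' (toOuterMeasure_le_one _ _)).trans le_self_add
        · rw [Set.indicator_of_notMem ha, zero_add]
          by_cases hs : a ∈ p.support
          · exact mul_le_mul_right (h a hs ha) _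
          · rw [(p.apply_eq_zero_iff a).2 hs]
            simp
    _ = ∑' a, A.indicator (⇑p) a + c := by
        rw [ENNReal.tsum_add, ENNReal.tsum_mul_right, p.tsum_coe, one_mul]

lemma ofReal_one_sub_le_toOuterMeasure {α : Type*} (p : PMF α) {A : Set α} {δ : ℝ} (hδ : 0 ≤ δ)
    (h : p.toOuterMeasure Aᶜ ≤ ENNReal.ofReal δ) :
    ENNReal.ofReal (1 - δ) ≤ p.toOuterMeasure A := by
  have h1 : (1 : ENNReal) ≤ p.toOuterMeasure A + p.toOuterMeasure Aᶜ := by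
    rw [← (p.toOuterMeasure_apply_eq_one_iff Set.univ).2 (Set.subset_univ _),
      ← Set.union_compl_self A]
    exact MeasureTheory.measure_union_le _ _
  rw [ENNReal.ofReal_sub _ hδ, ENNReal.ofReal_one]
  exact tsub_le_iff_right.2 (h1.trans (by gcongr))

/-- The failure probability after a sampling step is an average of the failure probabilities `u` and
`v` after removing an index of `R` inside and outside `T`, weighted with the masses of `x` on
`R ∩ T` and `R \ T`. -/
lemma toOuterMeasure_unregularize_bind_le {β : Type*} {R T : Finset (Fin n)} {x : E n}
    (F : Finset (Fin n) → PMF β) (B : Set β) {u v w : ℝ}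
    (hpos : 0 < ∑ i ∈ R ∩ T, x i ^ 2)
    (hu : ∀ i ∈ R ∩ T, (F (R.erase i)).toOuterMeasure B ≤ ENNReal.ofReal u)
    (hv : ∀ i ∈ R \ T, (F (R.erase i)).toOuterMeasure B ≤ ENNReal.ofReal v)
    (hu0 : 0 ≤ u) (hv0 : 0 ≤ v)
    (hw : (∑ i ∈ R ∩ T, x i ^ 2) * u + (∑ i ∈ R \ T, x i ^ 2) * v
      ≤ ((∑ i ∈ R ∩ T, x i ^ 2) + ∑ i ∈ R \ T, x i ^ 2) * w) :
    ((unregularize R x).bind F).toOuterMeasure B ≤ ENNReal.ofReal w := by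
  set a := ∑ i ∈ R ∩ T, x i ^ 2
  set b := ∑ i ∈ R \ T, x i ^ 2
  have hb0 : 0 ≤ b := Finset.sum_nonneg fun i _ => sq_nonneg _
  have hW : ∑' i, sampleWeight R x i = ENNReal.ofReal (a + b) := by
    rw [tsum_fintype, Finset.sum_inter_add_sum_sdiff R T fun i => x i ^ 2,
      ENNReal.ofReal_sum_of_nonneg fun i _ => sq_nonneg _, ← Finset.univ_inter R,
      ← Finset.filter_mem_eq_inter, Finset.sum_filter]
    simp [sampleWeight]
  have hW0 : ∑' i, sampleWeight R x i ≠ 0 := by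
    rw [hW]
    simpa using by linarith
  unfold unregularize
  rw [dif_pos hW0, PMF.bind_map, PMF.toOuterMeasure_bind_apply, tsum_fintype]
  have hterm : ∀ i ∈ (Finset.univ : Finset (Fin n)),
      PMF.normalize (sampleWeight R x) hW0 (tsum_sampleWeight_ne_top R x) i
          * ((F ∘ fun i => R.erase i) i).toOuterMeasure B
        ≤ ENNReal.ofReal (((if i ∈ R ∩ T then x i ^ 2 * u else 0)
          + (if i ∈ R \ T then x i ^ 2 * v else 0)) / (a + b)) := by
    intro i _
    rw [PMF.normalize_apply, hW, sampleWeight]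
    by_cases hiR : i ∈ R
    · have hbound : ∀ t : ℝ, 0 ≤ t → (F (R.erase i)).toOuterMeasure B ≤ ENNReal.ofReal t →
          ENNReal.ofReal (x i ^ 2) * (ENNReal.ofReal (a + b))⁻¹ * (F (R.erase i)).toOuterMeasure B
            ≤ ENNReal.ofReal (x i ^ 2 * t / (a + b)) := by
        intro t ht h
        rw [← ENNReal.ofReal_inv_of_pos (by linarith), ← ENNReal.ofReal_mul (sq_nonneg _)]
        refine (mul_le_mul_right h _).trans (le_of_eq ?_)
        rw [← ENNReal.ofReal_mul (mul_nonneg (sq_nonneg _) (inv_nonneg.2 (by linarith)))]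
        congr 1
        ring
      by_cases hiT : i ∈ T
      · simpa [hiR, hiT] using hbound u hu0 (hu i (by simp [hiR, hiT]))
      · simpa [hiR, hiT] using hbound v hv0 (hv i (by simp [hiR, hiT]))
    · simp [hiR]
  refine (Finset.sum_le_sum hterm).trans ?_
  rw [← ENNReal.ofReal_sum_of_nonneg]
  · refine ENNReal.ofReal_le_ofReal ?_
    rw [← Finset.sum_div, Finset.sum_add_distrib, ← Finset.sum_filter, ← Finset.sum_filter,
      Finset.filter_mem_eq_inter, Finset.filter_mem_eq_inter, Finset.univ_inter,
      Finset.univ_inter, ← Finset.sum_mul, ← Finset.sum_mul, div_le_iff₀ (by linarith)]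
    linarith
  · intro i _
    refine div_nonneg (add_nonneg ?_ ?_) (by linarith) <;> split_ifs <;> positivity

/-! ### The core routine -/

/-- The bookkeeping for sparsity: if few indices outside `Z` have been unregularized and `Z` is
not contained in `S`, then most of `S` is still regularized and outside `Z`. -/
lemma le_card_inter_sdiff {s sstar : ℕ} {κ : ℝ} (hκ : 1 ≤ κ)
    (hs : (sstar : ℝ) * (12 * κ + 6) ≤ s) {S R Z : Finset (Fin n)} (hS : S.card = s)
    (hZ : Z.card ≤ sstar) (hc : ((Rᶜ \ Z).card : ℝ) ≤ (4 * κ + 6) * sstar) :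
    8 * κ * ((Z \ S).card : ℝ) ≤ (((S ∩ R) \ Z).card : ℝ) := by
  have h1 : S.card ≤ ((S ∩ R) \ Z).card + (Z ∩ S).card + (Rᶜ \ Z).card := by
    have hsub : S ⊆ ((S ∩ R) \ Z) ∪ (Z ∩ S) ∪ (Rᶜ \ Z) := by
      intro i hi
      by_cases h1 : i ∈ R <;> by_cases h2 : i ∈ Z <;> simp [hi, h1, h2]
    refine (Finset.card_le_card hsub).trans ((Finset.card_union_le _ _).trans ?_)
    gcongr
    exact Finset.card_union_le _ _
  have h2 := Finset.card_sdiff_add_card_inter Z S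
  have h1' : (s : ℝ) ≤ ((S ∩ R) \ Z).card + (Z ∩ S).card + (Rᶜ \ Z).card := by
    rw [hS] at h1
    exact_mod_cast h1
  have h2' : ((Z \ S).card : ℝ) + (Z ∩ S).card ≤ sstar := by
    have : (Z \ S).card + (Z ∩ S).card ≤ sstar := h2.trans_le hZ
    exact_mod_cast this
  have h3 : (0 : ℝ) ≤ (Z ∩ S).card := Nat.cast_nonneg _
  have h4 : (0 : ℝ) ≤ (Z \ S).card := Nat.cast_nonneg _
  nlinarith

/-- A swap that makes progress exchanges two distinct indices: if the new index were in `S`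
already, the support would shrink and the objective could not decrease. -/
lemma card_swapSupport_eq {g : E n → ℝ} {sel : Finset (Fin n) → (Fin n → ℝ) → Fin n}
    (hsel : IsArgmaxRule sel) {S : Finset (Fin n)} (hS : S.Nonempty) {x x' : E n}
    (hx : IsRestrictedMinimizer g S x) (hx' : supp x' ⊆ swapSupport sel g S x)
    (hlt : g x' < g x) : (swapSupport sel g S x).card = S.card := by
  have hj := swapOut_mem hsel hS x
  have hi : swapIn sel g x ∉ S := by
    intro hi
    rw [swapSupport, Finset.insert_eq_of_mem hi] at hx'
    exact absurd (hx.2 x' (hx'.trans (Finset.erase_subset _ _))) (not_le.2 hlt)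
  rw [swapSupport, Finset.card_erase_of_mem (Finset.mem_insert_of_mem hj),
    Finset.card_insert_of_notMem hi, Nat.add_sub_cancel]

/-- Swaps do not enlarge the support, so every output has at most `s` non-zero entries. -/
lemma isSparse_of_mem_support_coreLoop {f : E n → ℝ} {ρ : ℝ}
    {sel : Finset (Fin n) → (Fin n → ℝ) → Fin n} (hsel : IsArgmaxRule sel) {s : ℕ} (hs : 0 < s)
    {opt : ℝ} (k : ℕ) (σ : CoreState n) (hσ : σ.S.card ≤ s) (hx : supp σ.x ⊆ σ.S) {y : E n}
    (hy : y ∈ (coreLoop f ρ sel s opt k σ).support) : IsSparse s y := by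
  induction k generalizing σ with
  | zero =>
    rw [coreLoop, PMF.mem_support_pure_iff] at hy
    exact hy ▸ isSparse_of_supp_subset hx hσ
  | succ k ih =>
    rw [coreLoop] at hy
    split_ifs at hy with hret
    · rw [PMF.mem_support_pure_iff] at hy
      exact hy ▸ isSparse_of_supp_subset (supp_restrictedArgmin_subset f σ.S) hσ
    · obtain ⟨τ, hτ, hyτ⟩ := (PMF.mem_support_bind_iff _ _ _).1 hy
      simp only [coreStep] at hτ
      split_ifs at hτ with hprog
      · obtain ⟨R', -, rfl⟩ := (PMF.mem_support_map_iff _ _ _).1 hτ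
        exact ih ⟨σ.S, R', _⟩ hσ (supp_restrictedArgmin_subset _ _) hyτ
      · rw [PMF.mem_support_pure_iff] at hτ
        subst hτ
        refine ih ⟨_, σ.R, _⟩ ?_ (supp_restrictedArgmin_subset _ _) hyτ
        rcases σ.S.eq_empty_or_nonempty with h0 | h0
        · refine (Finset.card_le_card (Finset.erase_subset _ _)).trans ?_
          simpa [h0] using Nat.succ_le_of_lt hs
        · exact (card_swapSupport_le hsel (regularized f ρ σ.R) h0 σ.x).trans hσ

/-- The expected number of unregularized indices outside `Z` controls the failure probability. At a
state with `c` such indices so far and `h` regularized indices left in `Z`, the potential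
`c + 2 (κ + 1) h` does not increase in expectation: a sampling step removes an index outside `Z`
with odds less than `2 (κ + 1)` to one. A run fails only if more than `(4 κ + 6) s*` indices
outside `Z` are unregularized, since otherwise at least half of the iterations are swaps, each of
which reduces the gap to `opt` by the factor `1 - 1 / s`. -/
lemma toOuterMeasure_coreLoop_le {f : E n → ℝ} (hf : Differentiable ℝ f) {ρp ρm : ℝ}
    (hm : 0 < ρm) (hmp : ρm ≤ ρp) {s sstar : ℕ} (hsm : RestrictedSmooth f 2 ρp)
    (hc : RestrictedConvex f (s + sstar) ρm)
    {sel : Finset (Fin n) → (Fin n → ℝ) → Fin n} (hsel : IsArgmaxRule sel)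
    (hn : 0 < n) (hsstar : 0 < sstar) {z : E n} (hz : IsSparse sstar z)
    (hs1 : (sstar : ℝ) * (4 * (ρp / ρm) + 7) ≤ s)
    (hs2 : (sstar : ℝ) * (12 * (ρp / ρm) + 6) ≤ s)
    {opt ε D L T : ℝ} (hopt : f z ≤ opt) (hD : 0 ≤ D) (hL : 1 ≤ L)
    (hDL : D * Real.exp (-L) ≤ ε) (hT : 2 * s * L ≤ T) (k : ℕ) (σ : CoreState n)
    (hcard : σ.S.card = min s n)
    (hmin : IsRestrictedMinimizer (regularized f ρp σ.R) σ.S σ.x)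
    (hgap : regularized f ρp σ.R σ.x - opt
      ≤ D * Real.exp (-((T - k - (σ.Rᶜ.card : ℝ)) / s))) :
    (coreLoop f ρp sel s opt k σ).toOuterMeasure {x | opt + ε < f x}
      ≤ ENNReal.ofReal ((((σ.Rᶜ \ supp z).card : ℝ)
        + 2 * (ρp / ρm + 1) * ((σ.R ∩ supp z).card : ℝ)) / ((4 * (ρp / ρm) + 6) * sstar)) := by
  have hp : 0 < ρp := hm.trans_le hmp
  have hκ : 1 ≤ ρp / ρm := (one_le_div hm).2 hmp
  obtain ⟨κ, hκdef⟩ : ∃ κ, ρp / ρm = κ := ⟨_, rfl⟩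
  rw [hκdef] at hκ hs1 hs2 ⊢
  have hss : (1 : ℝ) ≤ sstar := by exact_mod_cast hsstar
  have hK : 0 < (4 * κ + 6) * (sstar : ℝ) := by positivity
  have hs0 : (0 : ℝ) < s := lt_of_lt_of_le (by positivity) hs1
  have hex : ∀ (R S : Finset (Fin n)), S.card ≤ s →
      IsRestrictedMinimizer (regularized f ρp R) S
        (restrictedArgmin (regularized f ρp R) S) := fun R S hS =>
    isRestrictedMinimizer_restrictedArgmin (exists_isRestrictedMinimizer hm hc
      (differentiable_regularized hf ρp R).continuous (le_regularized hp.le R) (by omega))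
  induction k generalizing σ with
  | zero =>
    rw [coreLoop]
    by_cases hfx : opt + ε < f σ.x
    · refine (toOuterMeasure_le_one _ _).trans ?_
      rw [ENNReal.one_le_ofReal, one_le_div hK]
      -- The gap exceeds `ε`, so fewer than `s L` of the `T` iterations were swaps.
      have h1 : D * Real.exp (-L) < D * Real.exp (-((T - (0 : ℕ) - (σ.Rᶜ.card : ℝ)) / s)) := by
        have := le_regularized (f := f) hp.le σ.R σ.x
        linarith
      have h2 := Real.exp_lt_exp.1 (lt_of_mul_lt_mul_left h1 hD)
      rw [neg_lt_neg_iff, div_lt_iff₀ hs0, Nat.cast_zero] at h2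
      have h3 : (σ.Rᶜ.card : ℝ) ≤ (σ.Rᶜ \ supp z).card + sstar := by
        have h4 := Finset.card_sdiff_add_card_inter σ.Rᶜ (supp z)
        have h5 : (σ.Rᶜ ∩ supp z).card ≤ sstar :=
          (Finset.card_le_card Finset.inter_subset_right).trans hz
        have h6 : σ.Rᶜ.card ≤ (σ.Rᶜ \ supp z).card + sstar := by omega
        exact_mod_cast h6
      have h7 : (0 : ℝ) ≤ 2 * (κ + 1) * ((σ.R ∩ supp z).card : ℝ) := by positivity
      nlinarith
    · rw [toOuterMeasure_pure_of_notMem (A := {x | opt + ε < f x}) hfx]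
      exact zero_le
  | succ k ih =>
    rw [coreLoop]
    split_ifs with hret
    · have hε : 0 ≤ ε := (mul_nonneg hD (Real.exp_pos _).le).trans hDL
      rw [toOuterMeasure_pure_of_notMem (by simpa using by linarith)]
      exact zero_le
    -- Once the potential has reached `(4 κ + 6) s*`, the claimed bound is trivial.
    rcases le_or_gt ((4 * κ + 6) * (sstar : ℝ))
      (((σ.Rᶜ \ supp z).card : ℝ) + 2 * (κ + 1) * ((σ.R ∩ supp z).card : ℝ)) with hbig | hsmall
    · refine (toOuterMeasure_le_one _ _).trans ?_
      rw [ENNReal.one_le_ofReal, one_le_div hK]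
      exact hbig
    have hSs : σ.S.card ≤ s := hcard.trans_le (min_le_left _ _)
    have hSne : σ.S.Nonempty := Finset.card_pos.1 (by
      rw [hcard]
      exact lt_min (by exact_mod_cast hs0) hn)
    have hS'card := card_swapSupport_le hsel (regularized f ρp σ.R) hSne σ.x
    have hx' := hex σ.R _ (hS'card.trans hSs)
    have hfmin : IsRestrictedMinimizer f σ.S (restrictedArgmin f σ.S) := by
      simpa [regularized_empty] using hex ∅ σ.S hSs
    have hgt : opt < regularized f ρp σ.R σ.x :=
      (not_le.1 hret).trans_le ((hfmin.2 _ hmin.1).trans (le_regularized hp.le _ _))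
    simp only [coreStep]
    split_ifs with hprog
    · -- A sampling step.
      have hmis : 0 < (supp z \ σ.S).card := by
        rw [Finset.card_pos, Finset.sdiff_nonempty]
        exact fun h => hret ((hfmin.2 z h).trans hopt)
      have hSeq : σ.S.card = s := by
        have hlt : σ.S.card < n := by
          obtain ⟨i, hi⟩ := Finset.card_pos.1 hmis
          have := Finset.card_lt_univ_of_notMem (Finset.mem_sdiff.1 hi).2
          simpa using this
        omega
      have hh0 : (0 : ℝ) ≤ 2 * (κ + 1) * ((σ.R ∩ supp z).card : ℝ) :=
        mul_nonneg (by linarith) (Nat.cast_nonneg _)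
      have hq := le_card_inter_sdiff hκ hs2 hSeq hz (by linarith : _ ≤ _)
      have hmle : ((supp z \ σ.S).card : ℝ) ≤ sstar := by
        exact_mod_cast (Finset.card_le_card Finset.sdiff_subset).trans hz
      have hmass := mass_lt_of_no_progress hf hm hmp hsm hc hsel hmin
        (isSparse_of_supp_subset (supp_sub_subset σ.x z)
          (((Finset.card_union_le _ _).trans (Nat.add_le_add hz
            ((Finset.card_le_card hmin.1).trans hSs))).trans (by omega)))
        hx' hopt hgt.le hprog hmis (by rw [hκdef]; nlinarith) (by rw [hκdef]; exact hq)
      rw [hκdef] at hmass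
      have hb0 : 0 ≤ ∑ i ∈ σ.R \ supp z, σ.x i ^ 2 := Finset.sum_nonneg fun i _ => sq_nonneg _
      have ha0 : 0 < ∑ i ∈ σ.R ∩ supp z, σ.x i ^ 2 :=
        pos_of_mul_pos_right (hb0.trans_lt hmass) (by linarith : 0 ≤ 2 * (κ + 1))
      have hnext : ∀ i ∈ σ.R, (coreLoop f ρp sel s opt k ⟨σ.S, σ.R.erase i,
          restrictedArgmin (regularized f ρp (σ.R.erase i)) σ.S⟩).toOuterMeasure
            {x | opt + ε < f x}
          ≤ ENNReal.ofReal (((((σ.R.erase i)ᶜ \ supp z).card : ℝ)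
            + 2 * (κ + 1) * ((σ.R.erase i ∩ supp z).card : ℝ)) / ((4 * κ + 6) * sstar)) := by
        intro i hi
        have hnew := hex (σ.R.erase i) σ.S hSs
        refine ih ⟨σ.S, σ.R.erase i, _⟩ hcard hnew ?_
        have h1 := (hnew.2 _ hmin.1).trans
          (regularized_mono (f := f) hp.le (Finset.erase_subset i σ.R) σ.x)
        have h2 : ((σ.R.erase i)ᶜ.card : ℝ) = (σ.Rᶜ.card : ℝ) + 1 := by
          rw [Finset.compl_erase, Finset.card_insert_of_notMem (by simpa using hi)]
          push_cast
          ring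
        have h3 : T - (k : ℝ) - ((σ.R.erase i)ᶜ.card : ℝ)
            = T - ((k + 1 : ℕ) : ℝ) - (σ.Rᶜ.card : ℝ) := by
          rw [h2]
          push_cast
          ring
        simp only [h3]
        linarith
      rw [PMF.bind_map]
      refine toOuterMeasure_unregularize_bind_le (T := supp z)
        (u := (((σ.Rᶜ \ supp z).card : ℝ) + 2 * (κ + 1) * (((σ.R ∩ supp z).card : ℝ) - 1))
          / ((4 * κ + 6) * sstar))
        (v := (((σ.Rᶜ \ supp z).card : ℝ) + 1 + 2 * (κ + 1) * ((σ.R ∩ supp z).card : ℝ))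
          / ((4 * κ + 6) * sstar)) _ _ ha0 ?_ ?_ ?_ ?_ ?_
      · intro i hi
        obtain ⟨hiR, hiz⟩ := Finset.mem_inter.1 hi
        refine (hnext i hiR).trans (le_of_eq ?_)
        rw [Finset.compl_erase, Finset.insert_sdiff_of_mem _ hiz, Finset.erase_inter,
          Finset.card_erase_of_mem hi, Nat.cast_sub (Finset.card_pos.2 ⟨i, hi⟩), Nat.cast_one]
      · intro i hi
        obtain ⟨hiR, hiz⟩ := Finset.mem_sdiff.1 hi
        refine (hnext i hiR).trans (le_of_eq ?_)
        rw [Finset.compl_erase, Finset.insert_sdiff_of_notMem _ hiz,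
          Finset.card_insert_of_notMem (by simp [hiR]), Finset.erase_inter,
          Finset.erase_eq_of_notMem (by simp [hiz]), Nat.cast_add, Nat.cast_one]
      · have h1 : (1 : ℝ) ≤ ((σ.R ∩ supp z).card : ℝ) := by
          have : 0 < (σ.R ∩ supp z).card := Finset.card_pos.2
            (Finset.nonempty_of_sum_ne_zero ha0.ne')
          exact_mod_cast this
        have h2 : 0 ≤ 2 * (κ + 1) * (((σ.R ∩ supp z).card : ℝ) - 1) :=
          mul_nonneg (by linarith) (by linarith)
        exact div_nonneg (add_nonneg (Nat.cast_nonneg _) h2) hK.le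
      · exact div_nonneg (add_nonneg (add_nonneg (Nat.cast_nonneg _) zero_le_one) hh0) hK.le
      · rw [mul_div_assoc', mul_div_assoc', mul_div_assoc', ← add_div]
        refine div_le_div_of_nonneg_right ?_ hK.le
        linarith
    · -- A swap with sufficient progress.
      have hx'lt := not_lt.1 hprog
      have hlt : regularized f ρp σ.R (restrictedArgmin (regularized f ρp σ.R)
          (swapSupport sel (regularized f ρp σ.R) σ.S σ.x)) < regularized f ρp σ.R σ.x := by
        have : 0 < 1 / (s : ℝ) * (regularized f ρp σ.R σ.x - opt) :=
          mul_pos (by positivity) (by linarith)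
        exact sub_pos.1 (this.trans_le hx'lt)
      rw [PMF.pure_bind]
      refine ih ⟨swapSupport sel (regularized f ρp σ.R) σ.S σ.x, σ.R, _⟩
        ((card_swapSupport_eq hsel hSne hmin hx'.1 hlt).trans hcard) hx' ?_
      have h1 : 1 - 1 / (s : ℝ) ≤ Real.exp (-(1 / (s : ℝ))) := by
        have := Real.add_one_le_exp (-(1 / (s : ℝ)))
        linarith
      have h2 : Real.exp (-(1 / (s : ℝ))) * (D * Real.exp (-((T - ((k + 1 : ℕ) : ℝ)
          - (σ.Rᶜ.card : ℝ)) / s))) = D * Real.exp (-((T - k - (σ.Rᶜ.card : ℝ)) / s)) := by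
        rw [mul_left_comm, ← Real.exp_add]
        congr 2
        push_cast
        ring
      rw [← h2]
      refine le_trans ?_ (mul_le_mul_of_nonneg_left hgap (Real.exp_pos _).le)
      refine le_trans ?_ (mul_le_mul_of_nonneg_right h1 (sub_nonneg.2 hgt.le))
      rw [sub_mul, one_mul]
      linarith

lemma card_filter_val_lt (n s : ℕ) :
    (Finset.univ.filter fun i : Fin n => (i : ℕ) < s).card = min s n := by
  rw [Fin.card_filter_val_lt, min_comm]

/-- By Markov's inequality for the potential of `toOuterMeasure_coreLoop_le`, a run of the core
routine with a feasible guess `opt` succeeds with probability at least one half. -/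
lemma toOuterMeasure_core_le {f : E n → ℝ} (hf : Differentiable ℝ f)
    (hbdd : BddBelow (Set.range f)) {ρp ρm : ℝ}
    (hm : 0 < ρm) (hmp : ρm ≤ ρp) {s sstar : ℕ} (hsm : RestrictedSmooth f 2 ρp)
    (hc : RestrictedConvex f (s + sstar) ρm)
    {sel : Finset (Fin n) → (Fin n → ℝ) → Fin n} (hsel : IsArgmaxRule sel)
    (hn : 0 < n) (hs0 : 0 < s) {z : E n} (hz : IsSparse sstar z)
    (hs1 : (sstar : ℝ) * (4 * (ρp / ρm) + 7) ≤ s)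
    (hs2 : (sstar : ℝ) * (12 * (ρp / ρm) + 6) ≤ s)
    {opt ε : ℝ} (hε : 0 < ε) (hopt : f z ≤ opt)
    (hL : 1 ≤ Real.log ((f 0 - ⨅ y, f y) / ε)) :
    (core f ρp sel s opt ε).toOuterMeasure {x | opt + ε < f x} ≤ ENNReal.ofReal (1 / 2) := by
  have hp : 0 < ρp := hm.trans_le hmp
  have hκ : 1 ≤ ρp / ρm := (one_le_div hm).2 hmp
  set L := Real.log ((f 0 - ⨅ y, f y) / ε) with hLdef
  have hs0' : (0 : ℝ) < s := by exact_mod_cast hs0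
  have hceil := Nat.le_ceil (2 * (s : ℝ) * L)
  have hcard := card_filter_val_lt n s
  have hcard' : (Finset.univ.filter fun i : Fin n => (i : ℕ) < s).card ≤ s + sstar := by omega
  simp only [core]
  rw [← hLdef]
  rcases Nat.eq_zero_or_pos sstar with h0 | hsstar
  · -- Here `z = 0`, and the test at the beginning of the first iteration succeeds.
    have hT : ⌈2 * (s : ℝ) * L⌉₊ ≠ 0 := (Nat.ceil_pos.2 (by positivity)).ne'
    obtain ⟨T, hT⟩ := Nat.exists_eq_succ_of_ne_zero hT
    have hfmin := isRestrictedMinimizer_restrictedArgmin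
      (exists_isRestrictedMinimizer hm hc hf.continuous (fun _ => le_rfl) hcard')
    have hz0 : supp z = ∅ := Finset.card_eq_zero.1 (Nat.le_zero.1 (h0 ▸ hz))
    have hle : f (restrictedArgmin f (Finset.univ.filter fun i : Fin n => (i : ℕ) < s)) ≤ opt :=
      (hfmin.2 z (by simp [hz0])).trans hopt
    rw [hT, coreLoop, if_pos hle, toOuterMeasure_pure_of_notMem (by simpa using by linarith)]
    exact zero_le
  · have hss : (1 : ℝ) ≤ sstar := by exact_mod_cast hsstar
    have hmin := isRestrictedMinimizer_restrictedArgmin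
      (exists_isRestrictedMinimizer hm hc
        (differentiable_regularized hf ρp Finset.univ).continuous
        (le_regularized hp.le Finset.univ) hcard')
    have hB : ⨅ y, f y ≤ f z := ciInf_le hbdd z
    have hD0 : 0 < (f 0 - ⨅ y, f y) / ε := by
      by_contra h
      have h1 : 0 ≤ (f 0 - ⨅ y, f y) / ε :=
        div_nonneg (sub_nonneg.2 (ciInf_le hbdd 0)) hε.le
      rw [le_antisymm (not_lt.1 h) h1, Real.log_zero] at hLdef
      linarith
    have hD : 0 < f 0 - ⨅ y, f y := (div_pos_iff_of_pos_right hε).1 hD0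
    refine (toOuterMeasure_coreLoop_le hf hm hmp hsm hc hsel hn hsstar hz hs1 hs2 hopt hD.le hL
      (ε := ε) ?_ hceil _ ⟨_, Finset.univ, _⟩ hcard hmin ?_).trans ?_
    · rw [Real.exp_neg, Real.exp_log hD0]
      field_simp
      exact le_rfl
    · have h1 := hmin.2 0 (by simp [supp])
      rw [regularized_zero] at h1
      refine (sub_le_sub_right h1 opt).trans ?_
      simp only [Finset.compl_univ, Finset.card_empty, Nat.cast_zero, sub_self, zero_div, neg_zero,
        Real.exp_zero, mul_one]
      linarith
    · refine ENNReal.ofReal_le_ofReal ?_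
      simp only [Finset.compl_univ, Finset.empty_sdiff, Finset.card_empty, Nat.cast_zero, zero_add,
        Finset.univ_inter]
      rw [div_le_div_iff₀ (by positivity) two_pos]
      have : ((supp z).card : ℝ) ≤ sstar := by exact_mod_cast hz
      nlinarith

lemma isSparse_of_mem_support_core {f : E n → ℝ} {ρ : ℝ}
    {sel : Finset (Fin n) → (Fin n → ℝ) → Fin n} (hsel : IsArgmaxRule sel) {s : ℕ} (hs : 0 < s)
    {opt ε : ℝ} {y : E n} (hy : y ∈ (core f ρ sel s opt ε).support) : IsSparse s y :=
  isSparse_of_mem_support_coreLoop hsel hs _ _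
    ((card_filter_val_lt n s).trans_le (min_le_left _ _)) (supp_restrictedArgmin_subset _ _) hy

/-! ### Boosting and binary search -/

lemma le_of_mem_support_robustLoop {f : E n → ℝ} {run : PMF (E n)} (k : ℕ) (x y : E n)
    (hy : y ∈ (robustLoop f run k x).support) : f y ≤ f x := by
  induction k generalizing x with
  | zero =>
    rw [robustLoop, PMF.mem_support_pure_iff] at hy
    rw [hy]
  | succ k ih =>
    rw [robustLoop] at hy
    obtain ⟨a, -, ha⟩ := (PMF.mem_support_bind_iff _ _ _).1 hy
    refine (ih _ ha).trans ?_
    split_ifs with h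
    · exact h.le
    · exact le_rfl

lemma robustLoop_induction {f : E n → ℝ} {run : PMF (E n)} {P : E n → Prop}
    (hrun : ∀ a ∈ run.support, P a) (k : ℕ) {x y : E n} (hx : P x)
    (hy : y ∈ (robustLoop f run k x).support) : P y := by
  induction k generalizing x with
  | zero =>
    rw [robustLoop, PMF.mem_support_pure_iff] at hy
    rwa [hy]
  | succ k ih =>
    rw [robustLoop] at hy
    obtain ⟨a, ha, hay⟩ := (PMF.mem_support_bind_iff _ _ _).1 hy
    refine ih ?_ hay
    split_ifs
    · exact hrun a ha
    · exact hx

/-- Independent repetitions fail only if every single run fails. -/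
lemma toOuterMeasure_robustLoop_le {f : E n → ℝ} {run : PMF (E n)} {c : ℝ} {q : ENNReal}
    (hq : run.toOuterMeasure {x | c < f x} ≤ q) (k : ℕ) (x : E n) :
    (robustLoop f run k x).toOuterMeasure {x | c < f x} ≤ q ^ k := by
  induction k generalizing x with
  | zero =>
    rw [pow_zero]
    exact toOuterMeasure_le_one _ _
  | succ k ih =>
    rw [robustLoop, PMF.toOuterMeasure_bind_apply, pow_succ']
    calc ∑' a, run a * (robustLoop f run k (if f a < f x then a else x)).toOuterMeasure
            {x | c < f x}
        ≤ ∑' a, {x | c < f x}.indicator (⇑run) a * q ^ k := by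
          refine ENNReal.tsum_le_tsum fun a => ?_
          by_cases ha : c < f a
          · rw [Set.indicator_of_mem (show a ∈ {x | c < f x} from ha)]
            exact mul_le_mul_right (ih _) _
          · rw [toOuterMeasure_eq_zero_of_forall, mul_zero]
            · exact zero_le
            · intro y hy hcy
              have h1 := le_of_mem_support_robustLoop k _ y hy
              have h2 : f (if f a < f x then a else x) ≤ f a := by
                split_ifs with h
                · exact le_rfl
                · exact not_lt.1 h
              exact ha (lt_of_lt_of_le hcy (h1.trans h2))
      _ = run.toOuterMeasure {x | c < f x} * q ^ k := by
          rw [ENNReal.tsum_mul_right, PMF.toOuterMeasure_apply]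
      _ ≤ q * q ^ k := mul_le_mul_left hq _

/-- `5 log N` repetitions of an experiment with failure probability `1/2` reduce it to
`1 / N`. -/
lemma half_pow_ceil_le {N : ℝ} (hN : 1 ≤ N) : (1 / 2 : ℝ) ^ ⌈5 * Real.log N⌉₊ ≤ 1 / N := by
  have hlog : 0 ≤ Real.log N := Real.log_nonneg hN
  have hN0 : 0 < N := by linarith
  have h1 := Nat.le_ceil (5 * Real.log N)
  have h2 : (1 / 2 : ℝ) ≤ Real.exp (-(1 / 5)) := by
    have := Real.add_one_le_exp (-(1 / 5) : ℝ)
    linarith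
  calc (1 / 2 : ℝ) ^ ⌈5 * Real.log N⌉₊ ≤ Real.exp (-(1 / 5)) ^ ⌈5 * Real.log N⌉₊ := by gcongr
    _ = Real.exp (⌈5 * Real.log N⌉₊ * (-(1 / 5))) := by rw [Real.exp_nat_mul]
    _ ≤ Real.exp (-Real.log N) := Real.exp_le_exp.2 (by linarith)
    _ = 1 / N := by rw [Real.exp_neg, Real.exp_log hN0, one_div]

/-- A union bound over the steps of the binary search. If each guess `m ≥ f z` is missed by more
than `ε / 3` with probability at most `δ`, then the search fails with probability at most
`6 δ log (3 (r - l) / ε)`: each step shrinks `r - l` at least by the factor `5 / 6`, and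
`6 log (6 / 5) ≥ 1`. -/
lemma toOuterMeasure_arhtLoop_le {f : E n → ℝ} {ρ : ℝ}
    {sel : Finset (Fin n) → (Fin n → ℝ) → Fin n} {s : ℕ} {ε δ : ℝ} (hε : 0 < ε)
    (hδ : 0 ≤ δ) {z : E n} {P : E n → Prop}
    (hP : ∀ m, ∀ y ∈ (robust f ρ sel s m (ε / 3) (⨅ z, f z)).support, P y)
    (hrob : ∀ m, f z ≤ m → (robust f ρ sel s m (ε / 3) (⨅ z, f z)).toOuterMeasure
      {x | m + ε / 3 < f x} ≤ ENNReal.ofReal δ)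
    (l r : ℝ) (b : E n) (hl : l ≤ f z) (hr : f b = r) (hb : P b) :
    (arhtLoop f ρ sel s ε hε l r b).toOuterMeasure {x | P x ∧ f x ≤ f z + ε}ᶜ
      ≤ ENNReal.ofReal (if ε < r - l then δ * (6 * Real.log (3 * (r - l) / ε)) else 0) := by
  induction hN : ⌈6 * (r - l) / ε⌉₊ using Nat.strong_induction_on generalizing l r b with
  | _ N ih =>
    rw [arhtLoop]
    split_ifs with h
    · have hφ : ∀ d : ℝ, d ≤ 5 / 6 * (r - l) →
          δ + (if ε < d then δ * (6 * Real.log (3 * d / ε)) else 0)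
            ≤ δ * (6 * Real.log (3 * (r - l) / ε)) := by
        intro d hd
        have hrl : 0 < r - l := hε.trans h
        split_ifs with hdε
        · have hd0 : 0 < d := hε.trans hdε
          have h1 : 3 * (r - l) / ε = 3 * d / ε * ((r - l) / d) := by
            field_simp
          have h2 : 1 / 6 ≤ Real.log ((r - l) / d) := by
            have h3 := Real.one_sub_inv_le_log_of_pos (div_pos hrl hd0)
            have h4 : ((r - l) / d)⁻¹ ≤ 5 / 6 := by
              rw [inv_div, div_le_iff₀ hrl]
              exact hd
            linarith
          rw [h1, Real.log_mul (by positivity) (by positivity)]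
          nlinarith
        · have h2 : 1 / 6 ≤ Real.log (3 * (r - l) / ε) := by
            have h0 : 0 < 3 * (r - l) / ε := by positivity
            have h3 := Real.one_sub_inv_le_log_of_pos h0
            have h4 : (3 * (r - l) / ε)⁻¹ ≤ 1 / 3 := by
              rw [inv_div, div_le_iff₀ (by linarith)]
              linarith
            linarith
          nlinarith
      have hlt : ∀ d : ℝ, d ≤ 5 / 6 * (r - l) → ⌈6 * d / ε⌉₊ < N := by
        intro d hd
        rw [← hN]
        have h1 : (6 : ℝ) < 6 * (r - l) / ε := by
          rw [lt_div_iff₀ hε]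
          linarith
        rw [Nat.lt_ceil]
        rcases le_or_gt (6 * d / ε) 0 with h0 | h0
        · rw [Nat.ceil_eq_zero.2 h0, Nat.cast_zero]
          linarith
        · have h2 := Nat.ceil_lt_add_one h0.le
          have h3 : 6 * d / ε ≤ 5 / 6 * (6 * (r - l) / ε) := by
            rw [← mul_div_assoc]
            exact div_le_div_of_nonneg_right (by linarith) hε.le
          linarith
      have hd1 : r - (l + r) / 2 ≤ 5 / 6 * (r - l) := by linarith
      have hstep : ∀ a ∈ (robust f ρ sel s ((l + r) / 2) (ε / 3) (⨅ z, f z)).support,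
          a ∉ {x | f z ≤ (l + r) / 2 ∧ (l + r) / 2 + ε / 3 < f x} →
          (if hx : (l + r) / 2 + ε / 3 < f a then arhtLoop f ρ sel s ε hε ((l + r) / 2) r b
            else arhtLoop f ρ sel s ε hε l (f a) a).toOuterMeasure {x | P x ∧ f x ≤ f z + ε}ᶜ
          ≤ ENNReal.ofReal (δ * (6 * Real.log (3 * (r - l) / ε)) - δ) := by
        intro a ha hgood
        split_ifs with hx
        · have hlow : (l + r) / 2 ≤ f z := by
            by_contra h0
            exact hgood ⟨(not_le.1 h0).le, hx⟩
          refine (ih _ (hlt _ hd1) ((l + r) / 2) r b hlow hr hb rfl).trans ?_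
          exact ENNReal.ofReal_le_ofReal (by linarith [hφ _ hd1])
        · have hd2 : f a - l ≤ 5 / 6 * (r - l) := by linarith
          refine (ih _ (hlt _ hd2) l (f a) a hl rfl (hP _ a ha) rfl).trans ?_
          exact ENNReal.ofReal_le_ofReal (by linarith [hφ _ hd2])
      refine (toOuterMeasure_bind_le _ _ _ _ _ hstep).trans ?_
      have hbad : (robust f ρ sel s ((l + r) / 2) (ε / 3) (⨅ z, f z)).toOuterMeasure
          {x | f z ≤ (l + r) / 2 ∧ (l + r) / 2 + ε / 3 < f x} ≤ ENNReal.ofReal δ := by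
        by_cases hm : f z ≤ (l + r) / 2
        · simpa [hm] using hrob _ hm
        · simp [hm]
      refine (add_le_add_left hbad _).trans ?_
      have h0 := hφ 0 (by linarith)
      rw [if_neg (by linarith)] at h0
      rw [← ENNReal.ofReal_add hδ (by linarith), add_sub_cancel]
    · have hmem : b ∉ {x | P x ∧ f x ≤ f z + ε}ᶜ :=
        fun hn => hn ⟨hb, by linarith⟩
      rw [toOuterMeasure_pure_of_notMem hmem]
      exact zero_le

/-- The binary search outputs an `s`-sparse vector within `ε` of `f z`, except with probability
`1 / n`. -/
lemma toOuterMeasure_arht_le {f : E n → ℝ} (hf : Differentiable ℝ f)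
    (hbdd : BddBelow (Set.range f)) {ρp ρm : ℝ}
    (hm : 0 < ρm) (hmp : ρm ≤ ρp) {s sstar : ℕ} (hsm : RestrictedSmooth f 2 ρp)
    (hc : RestrictedConvex f (s + sstar) ρm)
    {sel : Finset (Fin n) → (Fin n → ℝ) → Fin n} (hsel : IsArgmaxRule sel)
    (hn : 0 < n) (hs0 : 0 < s) {z : E n} (hz : IsSparse sstar z)
    (hs1 : (sstar : ℝ) * (4 * (ρp / ρm) + 7) ≤ s)
    (hs2 : (sstar : ℝ) * (12 * (ρp / ρm) + 6) ≤ s) {ε : ℝ} (hε : 0 < ε) :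
    (arht f ρp sel s ε hε).toOuterMeasure {x | IsSparse s x ∧ f x ≤ f z + ε}ᶜ
      ≤ ENNReal.ofReal (1 / n) := by
  have hsparse : ∀ m, ∀ y ∈ (robust f ρp sel s m (ε / 3) (⨅ z, f z)).support, IsSparse s y :=
    fun m y hy => robustLoop_induction (P := IsSparse s)
      (fun a ha => isSparse_of_mem_support_core hsel hs0 ha) _ (isSparse_zero s) hy
  have hB : ⨅ y, f y ≤ f z := ciInf_le hbdd z
  have hn1 : (1 : ℝ) ≤ n := by exact_mod_cast hn
  unfold arht
  rcases le_or_gt (f 0 - ⨅ y, f y) ε with hle | hgt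
  · have hnot : ¬ ε < f 0 - ⨅ y, f y := not_lt.2 hle
    have hmem : (0 : E n) ∉ {x | IsSparse s x ∧ f x ≤ f z + ε}ᶜ :=
      fun hn => hn ⟨isSparse_zero s, by linarith⟩
    rw [arhtLoop, dif_neg hnot, toOuterMeasure_pure_of_notMem hmem]
    exact zero_le
  · set L := Real.log ((f 0 - ⨅ y, f y) / (ε / 3)) with hLdef
    have hL : 1 ≤ L := by
      rw [hLdef, Real.le_log_iff_exp_le (div_pos (hε.trans hgt) (by positivity)),
        le_div_iff₀ (by positivity)]
      have := Real.exp_one_lt_d9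
      nlinarith
    have hN : 1 ≤ 6 * (n : ℝ) * L := by nlinarith
    have hrob : ∀ m, f z ≤ m → (robust f ρp sel s m (ε / 3) (⨅ z, f z)).toOuterMeasure
        {x | m + ε / 3 < f x} ≤ ENNReal.ofReal (1 / (6 * (n : ℝ) * L)) := by
      intro m hfm
      have h1 := toOuterMeasure_core_le hf hbdd hm hmp hsm hc hsel hn hs0 hz hs1 hs2
        (ε := ε / 3) (by positivity) hfm hL
      refine (toOuterMeasure_robustLoop_le h1 _ _).trans ?_
      rw [← ENNReal.ofReal_pow (by norm_num)]
      exact ENNReal.ofReal_le_ofReal (half_pow_ceil_le hN)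
    refine (toOuterMeasure_arhtLoop_le hε (by positivity) hsparse hrob _ _ _ hB rfl
      (isSparse_zero s)).trans (ENNReal.ofReal_le_ofReal ?_)
    rw [if_pos hgt]
    have h1 : 3 * (f 0 - ⨅ y, f y) / ε = (f 0 - ⨅ y, f y) / (ε / 3) := by
      field_simp
    rw [h1, ← hLdef]
    refine le_of_eq ?_
    field_simp

/-! ### From function values to distances -/

/-- If `z` minimizes `f` on its own support, then the gradient at `z` sees only the part of `x - z`
off that support, which is `s`-sparse like `x`. -/
lemma abs_inner_gradient_sub_le {f : E n → ℝ} (hf : Differentiable ℝ f) {s sstar : ℕ} {z : E n}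
    (hz : IsSparse sstar z) {ζ : ℝ}
    (hζ : IsRGOC f z (s + sstar) ζ ∨
      (IsRestrictedMinimizer f (supp z) z ∧ IsRGOC f z s ζ))
    {x : E n} (hx : IsSparse s x) : |inner ℝ (gradient f z) (x - z)| ≤ ζ * ‖x - z‖ := by
  rcases hζ with h | ⟨hmin, h⟩
  · exact h.1.2 _ (hx.sub hz)
  · have hsub : supp (restrict (x - z) (supp z)ᶜ) ⊆ supp x := by
      rw [supp_subset_iff]
      intro i hi
      have hxi : x i = 0 := by simpa [mem_supp] using hi
      by_cases hiz : z i = 0 <;> simp [restrict, mem_supp, hxi, hiz]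
    have h1 := h.1.2 _ (isSparse_of_supp_subset hsub hx)
    have h2 : inner ℝ (gradient f z) (restrict (x - z) (supp z)ᶜ)
        = inner ℝ (gradient f z) (x - z) := by
      rw [inner_eq_sum, inner_eq_sum]
      refine Finset.sum_congr rfl fun i _ => ?_
      by_cases hi : i ∈ supp z
      · simp [hmin.gradient_apply_eq_zero hf hi]
      · simp [restrict, hi]
    rw [h2] at h1
    exact h1.trans (mul_le_mul_of_nonneg_left (norm_restrict_le _ _) h.1.1)

/-- A solution of a quadratic inequality is bounded by the larger root of the quadratic. -/
lemma le_of_quadratic_le {ρ ζ ε d : ℝ} (hρ : 0 < ρ)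
    (h : ρ / 2 * d ^ 2 ≤ ε + ζ * d) : d ≤ (ζ + √(ζ ^ 2 + 2 * ε * ρ)) / ρ := by
  rw [le_div_iff₀ hρ]
  have h1 : |d * ρ - ζ| ≤ √(ζ ^ 2 + 2 * ε * ρ) := Real.abs_le_sqrt (by nlinarith)
  linarith [le_abs_self (d * ρ - ζ)]

end ARHT

theorem mainTheorem3 {n : ℕ} (f : EuclideanSpace ℝ (Fin n) → ℝ)
    (hf : Differentiable ℝ f) (hbdd : BddBelow (Set.range f))
    (s sstar : ℕ) (xstar : EuclideanSpace ℝ (Fin n)) (hxstar : ARHT.IsSparse sstar xstar)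
    (ρp ρm ζ : ℝ)
    (hρp : ARHT.IsRSSConstant f 2 ρp)
    (hρm : ARHT.IsRSCConstant f (s + sstar) ρm) (hρm_pos : 0 < ρm)
    (hζ : ARHT.IsRGOC f xstar (s + sstar) ζ ∨
      (ARHT.IsRestrictedMinimizer f (ARHT.supp xstar) xstar ∧ ARHT.IsRGOC f xstar s ζ))
    (hs : (sstar : ℝ) * max (4 * (ρp / ρm) + 7) (12 * (ρp / ρm) + 6) ≤ (s : ℝ))
    (sel : Finset (Fin n) → (Fin n → ℝ) → Fin n) (hsel : ARHT.IsArgmaxRule sel)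
    (ε : ℝ) (hε : 0 < ε) :
    ENNReal.ofReal (1 - 1 / (n : ℝ)) ≤
      (ARHT.arht f ρp sel s ε hε).toOuterMeasure
        {x | ARHT.IsSparse s x ∧
          f x ≤ f xstar + ε ∧
          ‖x - xstar‖ ≤ (ζ + √(ζ ^ 2 + 2 * ε * ρm)) / ρm ∧
          (0 < ζ → ‖x - xstar‖ ≤ ζ / ρm * (1 + √(1 + 2 * ε * (ρm / ζ ^ 2)))) ∧
          ∀ θ : ℝ, 0 < θ → ε ≤ ζ ^ 2 / ρm * (θ * (1 + θ / 2)) →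
            ‖x - xstar‖ ≤ (2 + θ) * (ζ / ρm)} := by
  have hsm : ARHT.RestrictedSmooth f 2 ρp := hρp.1
  have hc : ARHT.RestrictedConvex f (s + sstar) ρm := hρm.1.2
  -- In dimension zero every real number satisfies the smoothness inequality, so none is least.
  have hn : 0 < n := by
    rcases Nat.eq_zero_or_pos n with rfl | h
    · have hmem : ρp - 1 ∈ {c : ℝ | ∀ x y : ARHT.E 0, ARHT.IsSparse 2 (y - x) →
          f y ≤ f x + inner ℝ (gradient f x) (y - x) + c / 2 * ‖y - x‖ ^ 2} := by
        intro x y _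
        simp [Subsingleton.elim y x]
      linarith [hρp.2 hmem]
    · exact h
  -- Likewise, at sparsity level zero there is no greatest convexity constant.
  have hk : 1 ≤ s + sstar := by
    by_contra h0
    have hmem : ρm + 1 ∈ {c : ℝ | 0 ≤ c ∧ ∀ x y : ARHT.E n, ARHT.IsSparse (s + sstar) (y - x) →
        f x + inner ℝ (gradient f x) (y - x) + c / 2 * ‖y - x‖ ^ 2 ≤ f y} := by
      refine ⟨by linarith, fun x y hxy => ?_⟩
      have hcard : (ARHT.supp (y - x)).card = 0 := by
        have : (ARHT.supp (y - x)).card ≤ s + sstar := hxy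
        omega
      have hxy0 : y - x = 0 := by
        ext i
        have hi : i ∉ ARHT.supp (y - x) := by simp [Finset.card_eq_zero.1 hcard]
        simpa [ARHT.mem_supp] using hi
      rw [sub_eq_zero.1 hxy0]
      simp
    linarith [hρm.2 hmem]
  have hmp : ρm ≤ ρp := hc.le_of_restrictedSmooth hsm hk one_le_two hn
  have hκ : 1 ≤ ρp / ρm := (one_le_div hρm_pos).2 hmp
  have hs1 : (sstar : ℝ) * (4 * (ρp / ρm) + 7) ≤ s :=
    (mul_le_mul_of_nonneg_left (le_max_left _ _) (Nat.cast_nonneg _)).trans hs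
  have hs2 : (sstar : ℝ) * (12 * (ρp / ρm) + 6) ≤ s :=
    (mul_le_mul_of_nonneg_left (le_max_right _ _) (Nat.cast_nonneg _)).trans hs
  have hs0 : 0 < s := by
    rcases Nat.eq_zero_or_pos sstar with h0 | h0
    · omega
    · have h1 : (1 : ℝ) ≤ sstar := by exact_mod_cast h0
      have h2 : (0 : ℝ) < s := lt_of_lt_of_le (by positivity) hs1
      exact_mod_cast h2
  have hζ0 : 0 ≤ ζ := hζ.elim (fun h => h.1.1) fun h => h.2.1.1
  refine (ARHT.ofReal_one_sub_le_toOuterMeasure _ (by positivity)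
    (ARHT.toOuterMeasure_arht_le hf hbdd hρm_pos hmp hsm hc hsel hn hs0 hxstar hs1 hs2 hε)).trans
    ((ARHT.arht f ρp sel s ε hε).toOuterMeasure.mono ?_)
  rintro x ⟨hx, hfx⟩
  have hquad : ‖x - xstar‖ ≤ (ζ + √(ζ ^ 2 + 2 * ε * ρm)) / ρm := by
    refine ARHT.le_of_quadratic_le hρm_pos ?_
    have h1 := hc xstar x (hx.sub hxstar)
    have h2 := neg_le_of_abs_le (ARHT.abs_inner_gradient_sub_le hf hxstar hζ hx)
    linarith
  refine ⟨hx, hfx, hquad, fun hζpos => hquad.trans (le_of_eq ?_), fun θ hθ hεθ => ?_⟩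
  · have h1 : ζ ^ 2 + 2 * ε * ρm = ζ ^ 2 * (1 + 2 * ε * (ρm / ζ ^ 2)) := by
      field_simp
    rw [h1, Real.sqrt_mul (sq_nonneg ζ), Real.sqrt_sq hζ0]
    ring
  · refine hquad.trans ?_
    rw [← mul_div_assoc]
    refine div_le_div_of_nonneg_right ?_ hρm_pos.le
    have h1 : ε * ρm ≤ ζ ^ 2 * (θ * (1 + θ / 2)) := by
      rwa [div_mul_eq_mul_div, le_div_iff₀ hρm_pos] at hεθ
    have h2 : √(ζ ^ 2 + 2 * ε * ρm) ≤ (1 + θ) * ζ :=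
      Real.sqrt_le_iff.2 ⟨by positivity, by nlinarith⟩
    linarith
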